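/- Let $\mathcal K:\mathbb R\to[0,\infty)$ be an even function whose moments $\mathfrak m_j=\int_{\mathbb R}\xi^j\mathcal K(\xi)\,d\xi$ are all finite, normalized so that $\mathfrak m_0=\mathfrak m_2=1$, $\mathfrak m_1=0$, and let $\tau>0$. Put $\Delta_j(u,\sigma)=\int_{\mathbb R}\xi^j\,\frac1\sigma\mathcal K\!\left(\frac{\xi-u}{\sigma}\right)d\xi$ and, for $W=(w_1,u_1,w_2,u_2,\sigma)$, $M_j(W)=w_1\Delta_j(u_1,\sigma)+w_2\Delta_j(u_2,\sigma)$ and $\mathcal M(W)=(M_0(W),\dots,M_4(W))$. Let $$\Omega=\{W: w_1,w_2>0,\ u_1<u_2,\ \sigma>0\},\qquad \Omega^{tot}=\{W: w_1,w_2>0,\ u_1\le u_2,\ \sigma>0\},\qquad \mathbb G=\mathcal M(\Omega^{tot}).$$ The two-node EQMOM moment system is $$\partial_tM+A(M)\,\partial_xM=S(M),\qquad M\in\mathbb G,$$ where the closing moment is $\mathcal M_5(M)=M_5(W)$ for $W\in\Omega^{tot}$ with $\mathcal M(W)=M$; $A(M)\in\mathbb R^{5\times5}$ has ones on the superdiagonal,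 last row $(a_0,\dots,a_4)$ and zeros elsewhere; $a_j=\partial\mathcal M_5/\partial M_j$ on $\mathcal M(\Omega)$, and at $M=\mathcal M(W)$ with $u_1=u_2$ the $a_j$ are the limits of $a_j(\mathcal M(W'))$ as $W'\to W$, $W'\in\Omega$; and $$S_j(M)=\frac1\tau\left(\rho\int_{\mathbb R}\xi^j\frac{e^{-(\xi-U)^2/(2\theta)}}{\sqrt{2\pi\theta}}\,d\xi-M_j\right),\quad j=0,\dots,4,\qquad \rho=M_0,\ U=\frac{M_1}{M_0},\ \theta=\frac{M_2}{M_0}-U^2 .$$ Let $\mathcal E=\{M\in\mathbb G: S(M)=0\}$ and let $S_M$ be the Jacobian matrix of $S$. The system satisfies the structural stability condition if there are an integer $0<r\le5$ and matrices $P(M),A_0(M)\in\mathbb R^{5\times5}$, $\hat T(M)\in\mathbb R^{r\times r}$ such that (I) for every $M\in\mathcal E$, $P(M)$ and $\hat T(M)$ are invertible and $P\,S_M(M)\,P^{-1}=\mathrm{diag}(\mathbf 0_{(5-r)\times(5-r)},\hat T)$; (II) for every $M\in\mathbb G$, $A_0(M)$ is symmetric positive definite and $A_0A(M)=A(M)^TA_0$;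 (III) for every $M\in\mathcal E$, $A_0S_M(M)+S_M(M)^TA_0\le-P^T\,\mathrm{diag}(\mathbf 0_{(5-r)\times(5-r)},I_r)\,P$ in the sense of quadratic forms. **Theorem (Dissipativeness).** Suppose $3\le\mathfrak m_4<6$. Then the system is well defined ($\mathcal M$ is injective on $\Omega$, $\mathcal M_5$ is a well-defined function on $\mathbb G$ and is differentiable on $\mathcal M(\Omega)$, the limits defining $a_j$ at coinciding nodes exist and depend only on $M$, $S$ is differentiable on $\mathbb G$, and $\mathcal E\ne\emptyset$), and it satisfies the structural stability condition if and only if $3\le\mathfrak m_4<5$. -/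

import Mathlib

open Set Filter Topology MeasureTheory

noncomputable section

/-- The moment `𝔪_j = ∫ ξ^j K(ξ) dξ` of a kernel. -/
def kernelMoment (K : ℝ → ℝ) (j : ℕ) : ℝ := ∫ ξ, ξ ^ j * K ξ

/-- A kernel: a nonnegative function all of whose moments are finite, of total mass one. -/
structure IsKernel (K : ℝ → ℝ) : Prop where
  nonneg : ∀ ξ, 0 ≤ K ξ
  integrable : ∀ j : ℕ, Integrable (fun ξ => ξ ^ j * K ξ)
  mass : kernelMoment K 0 = 1

/-- A normalized kernel: mass one, mean zero, second moment one. -/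
structure IsNormalizedKernel (K : ℝ → ℝ) : Prop extends IsKernel K where
  mean : kernelMoment K 1 = 0
  second : kernelMoment K 2 = 1

/-- `Δ_j(u, σ) = ∫ ξ^j σ⁻¹ K((ξ - u)/σ) dξ`. -/
def nodeMoment (K : ℝ → ℝ) (j : ℕ) (u σ : ℝ) : ℝ :=
  ∫ ξ, ξ ^ j * ((1 / σ) * K ((ξ - u) / σ))

/-- The `j`-th velocity moment of the two-node ansatz with parameters
`W = (w₁, u₁, w₂, u₂, σ)`. -/
def ansatzMoment (K : ℝ → ℝ) (W : Fin 5 → ℝ) (j : ℕ) : ℝ :=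
  W 0 * nodeMoment K j (W 1) (W 4) + W 2 * nodeMoment K j (W 3) (W 4)

/-- The moment map `W ↦ (M₀, …, M₄)`. -/
def momentMap (K : ℝ → ℝ) (W : Fin 5 → ℝ) : Fin 5 → ℝ :=
  fun j => ansatzMoment K W (j : ℕ)

/-- `Ω`: positive weights, ordered distinct nodes, positive width. -/
def paramDomain : Set (Fin 5 → ℝ) := {W | 0 < W 0 ∧ 0 < W 2 ∧ W 1 < W 3 ∧ 0 < W 4}

/-- `Ω^tot`: as `Ω`, but the two nodes may coincide. -/
def paramDomainTot : Set (Fin 5 → ℝ) := {W | 0 < W 0 ∧ 0 < W 2 ∧ W 1 ≤ W 3 ∧ 0 < W 4}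

/-- The state space `𝔾 = 𝓜(Ω^tot)` of the moment system. -/
def stateSpace (K : ℝ → ℝ) : Set (Fin 5 → ℝ) := momentMap K '' paramDomainTot

/-- The closing moment `M₅` as a function of `M = (M₀, …, M₄)`, i.e. the fifth moment of the
ansatz whose parameters `W ∈ Ω^tot` solve `𝓜(W) = M`. -/
def closingMoment (K : ℝ → ℝ) (M : Fin 5 → ℝ) : ℝ :=
  ansatzMoment K (Function.invFunOn (momentMap K) paramDomainTot M) 5

/-- The partial derivatives `∂M₅/∂M_j`, `j = 0, …, 4`. -/
def closingGradient (K : ℝ → ℝ) (M : Fin 5 → ℝ) : Fin 5 → ℝ :=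
  fun j => fderiv ℝ (closingMoment K) M (Pi.single j 1)

open Classical in
/-- The coefficients `a_j(M)`. On `𝓜(Ω)` they are the partial derivatives `∂M₅/∂M_j`. At the other
points `𝓜(W)` of `𝔾`, where the two nodes coincide and `𝔾` is not a neighbourhood of the point,
they are the continuous extension from `Ω` in the parameters `W`. -/
def closingCoeff (K : ℝ → ℝ) (M : Fin 5 → ℝ) : Fin 5 → ℝ :=
  if M ∈ momentMap K '' paramDomain then closingGradient K M
  else limUnder (𝓝[paramDomain] (Function.invFunOn (momentMap K) paramDomainTot M))
    (fun W => closingGradient K (momentMap K W))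

/-- The coefficient matrix `A(M)`: ones on the superdiagonal, last row `(a₀, …, a₄)`. -/
def coeffMatrix (K : ℝ → ℝ) (M : Fin 5 → ℝ) : Matrix (Fin 5) (Fin 5) ℝ :=
  Matrix.of fun i j =>
    if i = 4 then closingCoeff K M j else if (j : ℕ) = (i : ℕ) + 1 then 1 else 0

/-- The Gaussian moments `Δ_j^eq(u, σ)`. -/
def gaussMoment (j : ℕ) (u σ : ℝ) : ℝ :=
  ∫ ξ, ξ ^ j * (1 / (Real.sqrt (2 * Real.pi) * σ) * Real.exp (-(ξ - u) ^ 2 / (2 * σ ^ 2)))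

/-- Mean velocity `U = M₁/M₀`. -/
def meanVelocity (M : Fin 5 → ℝ) : ℝ := M 1 / M 0

/-- Temperature `θ = M₂/M₀ - U²`. -/
def temperature (M : Fin 5 → ℝ) : ℝ := M 2 / M 0 - meanVelocity M ^ 2

/-- The BGK source `S(M) = τ⁻¹ (ρ Δ^eq(U, √θ) - M)` with `ρ = M₀`. -/
def bgkSource (τ : ℝ) (M : Fin 5 → ℝ) : Fin 5 → ℝ :=
  fun j => (1 / τ) *
    (M 0 * gaussMoment (j : ℕ) (meanVelocity M) (Real.sqrt (temperature M)) - M j)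

/-- The Jacobian matrix of a vector field. -/
def jacobianMatrix {N : ℕ} (S : (Fin N → ℝ) → (Fin N → ℝ)) (M : Fin N → ℝ) :
    Matrix (Fin N) (Fin N) ℝ :=
  Matrix.of fun i j => fderiv ℝ S M (Pi.single j 1) i

/-- The equilibrium manifold `{M ∈ G | S(M) = 0}`. -/
def equilibria {N : ℕ} (G : Set (Fin N → ℝ)) (S : (Fin N → ℝ) → (Fin N → ℝ)) :
    Set (Fin N → ℝ) := {M | M ∈ G ∧ S M = 0}

/-- The `N × N` matrix `diag(0, T)` with an `r × r` lower right block `T`. -/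
def lowerBlock {N r : ℕ} (hr : r ≤ N) (T : Matrix (Fin r) (Fin r) ℝ) :
    Matrix (Fin N) (Fin N) ℝ :=
  Matrix.reindex (finSumFinEquiv.trans (finCongr (Nat.sub_add_cancel hr)))
    (finSumFinEquiv.trans (finCongr (Nat.sub_add_cancel hr)))
    (Matrix.fromBlocks (0 : Matrix (Fin (N - r)) (Fin (N - r)) ℝ) 0 0 T)

/-- Yong's structural stability condition for `∂ₜM + A(M) ∂ₓM = S(M)` with state space `G`.
The three clauses are conditions (I), (II), (III), with common `r`, `P` and `A₀`; the matrix
inequality in (III) is that of quadratic forms. -/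
def StructuralStability {N : ℕ} (G : Set (Fin N → ℝ))
    (A : (Fin N → ℝ) → Matrix (Fin N) (Fin N) ℝ) (S : (Fin N → ℝ) → (Fin N → ℝ)) : Prop :=
  ∃ (r : ℕ) (_ : 0 < r) (hr : r ≤ N)
    (P : (Fin N → ℝ) → Matrix (Fin N) (Fin N) ℝ)
    (T : (Fin N → ℝ) → Matrix (Fin r) (Fin r) ℝ)
    (A₀ : (Fin N → ℝ) → Matrix (Fin N) (Fin N) ℝ),
    (∀ M ∈ equilibria G S, IsUnit (P M) ∧ IsUnit (T M) ∧
      P M * jacobianMatrix S M * (P M)⁻¹ = lowerBlock hr (T M)) ∧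
    (∀ M ∈ G, (A₀ M).PosDef ∧ A₀ M * A M = (A M).transpose * A₀ M) ∧
    (∀ M ∈ equilibria G S,
      (-((P M).transpose * lowerBlock hr (1 : Matrix (Fin r) (Fin r) ℝ) * P M) -
        (A₀ M * jacobianMatrix S M + (jacobianMatrix S M).transpose * A₀ M)).PosSemidef)

/-- The two-node moment system makes sense: `𝓜` is injective on `Ω`; `M₅` is a function of `M` on
`𝔾`; the coefficients `a_j` are genuine derivatives on `𝓜(Ω)` and genuine limits at coinciding
nodes; the source is differentiable on `𝔾`; and the equilibrium manifold is not empty. -/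
structure IsWellDefinedSystem (K : ℝ → ℝ) (τ : ℝ) : Prop where
  injOn : InjOn (momentMap K) paramDomain
  closing : ∀ W ∈ paramDomainTot, closingMoment K (momentMap K W) = ansatzMoment K W 5
  differentiable : ∀ W ∈ paramDomain, DifferentiableAt ℝ (closingMoment K) (momentMap K W)
  tendsto : ∀ W ∈ paramDomainTot, W 1 = W 3 →
    Tendsto (fun W' => closingGradient K (momentMap K W')) (𝓝[paramDomain] W)
      (𝓝 (closingCoeff K (momentMap K W)))
  source : ∀ M ∈ stateSpace K, DifferentiableAt ℝ (bgkSource τ) M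
  equilibrium : (equilibria (stateSpace K) (bgkSource τ)).Nonempty

end

/-! ### Moments of kernels -/

/-! Write `s = σ²`, `m = 𝔪₄` and `D = d/dx`. Averaging a polynomial of degree at most 5 over the
kernel centred at `u` gives the value at `u` of its image under `1 + s D²/2 + m s² D⁴/24`. By the
chain rule `∑ a_j ∂M_j/∂W_i = ∂M₅/∂W_i`, so the average `Q` of the characteristic polynomial `ξ⁵ - ∑
a_j ξ^j` has double zeros at both nodes. Hence `Q = (x - u₁)² (x - u₂)² (x - c)`, and the derivative
in the width fixes `c` (`paramCoeff_mul_grad`). Inverting the average, the characteristic polynomial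
is `(1 - s D²/2 + (6 - m) s² D⁴/24) Q`.

Hyperbolicity. For `3 ≤ m < 6` this operator factors, up to degree 5, as `exp(-b D²/2) (1 - a D²)`
with `b > 0` and `a ≥ 0`. The first factor produces simple real roots even from the double roots of
`Q`, and the second preserves them (`exists_charCoeff_roots`). Five distinct real eigenvalues give a
symmetrizer at every state (`exists_symmetrizer_of_roots`).

Equilibria. The source vanishes exactly when the nodes are balanced about `U` with variance `E =
√((m - 3)/2) σ²`. In the Hermite basis the source Jacobian is `-(1/τ) diag(0,0,0,1,1)`, and `A` is
tridiagonal with positive off-diagonal entries except possibly `4θ - 8E = 4(σ² - E)`, which is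
positive exactly for `m < 5`. In that case a diagonal matrix of Hermite weights serves (II) and
(III) together. Conversely, (I) and (III) make the kernel of the source Jacobian orthogonal to its
range with respect to `A₀`; combined with the symmetry of `A₀ A` this forces `4(σ² - E) > 0`
(`lt_five_of_structuralStability`).

Well-posedness. Nodes, width and total weight are recovered from the moments because, with variance
and third central moment fixed, the fourth is strictly monotone in the node variance
(`variance_le`). The inverse function theorem then gives the closing gradient on `𝓜(Ω)`, and its
formula extends continuously to coinciding nodes. -/

theorem nodeMoment_eq_sum {K : ℝ → ℝ} (hK : IsKernel K) (j : ℕ) (u : ℝ) {σ : ℝ} (hσ : 0 < σ) :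
    nodeMoment K j u σ =
      ∑ k ∈ Finset.range (j + 1), σ ^ k * u ^ (j - k) * (j.choose k) * kernelMoment K k := by
  have h1 : nodeMoment K j u σ = ∫ y, (σ * y + u) ^ j * K y := by
    have h2 : (fun ξ => ξ ^ j * ((1 / σ) * K ((ξ - u) / σ))) =
        fun ξ => (fun z => (1 / σ) * ((fun y => (σ * y + u) ^ j * K y) (z / σ))) (ξ - u) := by
      funext ξ
      have : σ * ((ξ - u) / σ) + u = ξ := by field_simp; ring
      simp only [this]
      ring
    unfold nodeMoment
    rw [h2, integral_sub_right_eq_self (fun z => (1 / σ) * ((fun y => (σ * y + u) ^ j * K y) (z / σ))),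
      integral_const_mul,
      Measure.integral_comp_div (fun y => (σ * y + u) ^ j * K y),
      abs_of_pos hσ, smul_eq_mul, ← mul_assoc, one_div_mul_cancel hσ.ne', one_mul]
  have h3 : (fun y => (σ * y + u) ^ j * K y) = fun y => ∑ k ∈ Finset.range (j + 1),
      σ ^ k * u ^ (j - k) * (j.choose k) * (y ^ k * K y) := by
    funext y
    rw [add_pow, Finset.sum_mul]
    refine Finset.sum_congr rfl fun k _ => ?_
    rw [mul_pow]
    ring
  rw [h1, h3, integral_finsetSum _ fun k _ => (hK.integrable k).const_mul _]
  simp only [integral_const_mul, kernelMoment]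

theorem kernelMoment_odd {K : ℝ → ℝ} (heven : Function.Even K) {j : ℕ} (hj : Odd j) :
    kernelMoment K j = 0 := by
  have h := integral_neg_eq_self (fun ξ => ξ ^ j * K ξ) (volume : Measure ℝ)
  simp only [heven _, hj.neg_pow, neg_mul, integral_neg] at h
  unfold kernelMoment
  linarith

/-- The polynomial `Δ_j(u, σ)`, `j ≤ 5`, of an even normalized kernel with fourth moment `m`. -/
noncomputable def nodePoly (m : ℝ) (j : ℕ) (u σ : ℝ) : ℝ :=
  match j with
  | 0 => 1
  | 1 => u
  | 2 => u ^ 2 + σ ^ 2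
  | 3 => u ^ 3 + 3 * u * σ ^ 2
  | 4 => u ^ 4 + 6 * u ^ 2 * σ ^ 2 + m * σ ^ 4
  | 5 => u ^ 5 + 10 * u ^ 3 * σ ^ 2 + 5 * m * u * σ ^ 4
  | _ => 0

theorem nodeMoment_eq_nodePoly {K : ℝ → ℝ} (hK : IsNormalizedKernel K) (h3 : kernelMoment K 3 = 0)
    {j : ℕ} (hj : j ≤ 4) (u : ℝ) {σ : ℝ} (hσ : 0 < σ) :
    nodeMoment K j u σ = nodePoly (kernelMoment K 4) j u σ := by
  rw [nodeMoment_eq_sum hK.toIsKernel j u hσ]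
  interval_cases j <;>
    simp [Finset.sum_range_succ, hK.mass, hK.mean, hK.second, h3, nodePoly, Nat.choose] <;> try ring

theorem nodeMoment_eq_nodePoly_of_even {K : ℝ → ℝ} (hK : IsNormalizedKernel K)
    (heven : Function.Even K) {j : ℕ} (hj : j ≤ 5) (u : ℝ) {σ : ℝ} (hσ : 0 < σ) :
    nodeMoment K j u σ = nodePoly (kernelMoment K 4) j u σ := by
  have m3 : kernelMoment K 3 = 0 := kernelMoment_odd heven (by decide)
  rcases Nat.lt_or_ge j 5 with h | h
  · exact nodeMoment_eq_nodePoly hK m3 (by omega) u hσ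
  obtain rfl : j = 5 := by omega
  have m5 : kernelMoment K 5 = 0 := kernelMoment_odd heven (by decide)
  rw [nodeMoment_eq_sum hK.toIsKernel 5 u hσ]
  simp [Finset.sum_range_succ, hK.mass, hK.mean, hK.second, m3, m5, nodePoly, Nat.choose]
  ring

/-! ### Gaussian moments -/

/-- The standard Gaussian density. -/
noncomputable def gaussKernel (x : ℝ) : ℝ := 1 / Real.sqrt (2 * Real.pi) * Real.exp (-(1 / 2) * x ^ 2)

theorem integrable_pow_mul_gaussKernel (j : ℕ) :
    Integrable fun x : ℝ => x ^ j * gaussKernel x := by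
  have h := integrable_rpow_mul_exp_neg_mul_sq (b := 1 / 2) (by norm_num) (s := (j : ℝ))
    (by linarith [(Nat.cast_nonneg j : (0 : ℝ) ≤ j)])
  simp only [Real.rpow_natCast] at h
  refine (h.const_mul (1 / Real.sqrt (2 * Real.pi))).congr (Eventually.of_forall fun x => ?_)
  simp only [gaussKernel]
  ring

theorem kernelMoment_gaussKernel_zero : kernelMoment gaussKernel 0 = 1 := by
  simp only [kernelMoment, gaussKernel, pow_zero, one_mul, integral_const_mul, integral_gaussian]
  rw [show Real.pi / (1 / 2) = 2 * Real.pi by ring]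
  exact one_div_mul_cancel (by positivity)

/-- Integration by parts: the derivative of `x ^ (j + 1) * gaussKernel x` integrates to zero. -/
theorem kernelMoment_gaussKernel_add_two (j : ℕ) :
    kernelMoment gaussKernel (j + 2) = (j + 1) * kernelMoment gaussKernel j := by
  have hd : ∀ x : ℝ, HasDerivAt (fun x => x ^ (j + 1) * gaussKernel x)
      ((j + 1) * (x ^ j * gaussKernel x) - x ^ (j + 2) * gaussKernel x) x := by
    intro x
    have h1 : HasDerivAt (fun x : ℝ => -(1 / 2) * x ^ 2) (-x) x := by
      have := (hasDerivAt_pow 2 x).const_mul (-(1 / 2) : ℝ)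
      exact this.congr_deriv (by push_cast; ring)
    have h2 := (hasDerivAt_pow (j + 1) x).mul (h1.exp.const_mul (1 / Real.sqrt (2 * Real.pi)))
    refine h2.congr_deriv ?_
    simp only [gaussKernel, Nat.add_sub_cancel]
    push_cast
    ring
  have h := integral_eq_zero_of_hasDerivAt_of_integrable hd
    (((integrable_pow_mul_gaussKernel j).const_mul _).sub (integrable_pow_mul_gaussKernel (j + 2)))
    (integrable_pow_mul_gaussKernel (j + 1))
  rw [integral_sub ((integrable_pow_mul_gaussKernel j).const_mul _)
    (integrable_pow_mul_gaussKernel (j + 2)), integral_const_mul] at h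
  unfold kernelMoment
  linarith

theorem even_gaussKernel : Function.Even gaussKernel := fun x => by simp [gaussKernel]

theorem isNormalizedKernel_gaussKernel : IsNormalizedKernel gaussKernel where
  nonneg x := by unfold gaussKernel; positivity
  integrable := integrable_pow_mul_gaussKernel
  mass := kernelMoment_gaussKernel_zero
  mean := kernelMoment_odd even_gaussKernel (by decide)
  second := by
    rw [kernelMoment_gaussKernel_add_two 0, kernelMoment_gaussKernel_zero]; norm_num

theorem kernelMoment_gaussKernel_four : kernelMoment gaussKernel 4 = 3 := by
  rw [kernelMoment_gaussKernel_add_two 2, isNormalizedKernel_gaussKernel.second]; norm_num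

/-- The Gaussian is itself an even normalized kernel, with fourth moment 3, so the kernel formulas
apply to it. -/
theorem gaussMoment_eq_nodePoly {j : ℕ} (hj : j ≤ 5) (u : ℝ) {σ : ℝ} (hσ : 0 < σ) :
    gaussMoment j u σ = nodePoly 3 j u σ := by
  rw [← kernelMoment_gaussKernel_four,
    ← nodeMoment_eq_nodePoly_of_even isNormalizedKernel_gaussKernel even_gaussKernel hj u hσ]
  unfold gaussMoment nodeMoment gaussKernel
  congr 1
  funext ξ
  have : -(1 / 2) * ((ξ - u) / σ) ^ 2 = -(ξ - u) ^ 2 / (2 * σ ^ 2) := by field_simp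
  rw [this]
  field_simp

/-! ### Polynomials with simple real roots -/

section SimpleRealRoots

open Polynomial Lagrange

/-- `g` is monic of degree `n` with `n` distinct real roots. -/
def HasSimpleRealRoots (n : ℕ) (g : ℝ[X]) : Prop :=
  ∃ x : Fin n → ℝ, StrictMono x ∧ g = nodal Finset.univ x

theorem HasSimpleRealRoots.monic {n : ℕ} {g : ℝ[X]} (hg : HasSimpleRealRoots n g) : g.Monic := by
  obtain ⟨x, -, rfl⟩ := hg
  exact nodal_monic

theorem HasSimpleRealRoots.natDegree {n : ℕ} {g : ℝ[X]} (hg : HasSimpleRealRoots n g) :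
    g.natDegree = n := by
  obtain ⟨x, -, rfl⟩ := hg
  simp

theorem eq_nodal_of_roots {n : ℕ} {g : ℝ[X]} (hm : g.Monic) (hd : g.natDegree = n)
    {x : Fin n → ℝ} (hx : StrictMono x) (h0 : ∀ i, g.eval (x i) = 0) :
    g = nodal Finset.univ x := by
  have hdeg : g.degree = (nodal Finset.univ x).degree := by
    rw [degree_nodal, degree_eq_natDegree hm.ne_zero, hd]; simp
  refine eq_of_degree_sub_lt_of_eval_index_eq (v := x) Finset.univ hx.injective.injOn ?_ ?_
  · refine (degree_sub_lt_left hdeg hm.ne_zero ?_).trans_le ?_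
    · rw [hm.leadingCoeff, nodal_monic.leadingCoeff]
    · rw [degree_eq_natDegree hm.ne_zero, hd]; simp
  · intro i hi
    rw [h0, eval_nodal_at_node hi]

/-- Alternating signs at `n + 1` points force `n` simple real roots. -/
theorem hasSimpleRealRoots_of_alternating {n : ℕ} {g : ℝ[X]} (hm : g.Monic) (hd : g.natDegree = n)
    {y : Fin (n + 1) → ℝ} (hy : StrictMono y)
    (hs : ∀ i : Fin (n + 1), 0 < (-1 : ℝ) ^ (n - (i : ℕ)) * g.eval (y i)) : HasSimpleRealRoots n g := by
  have key : ∀ i : Fin n, ∃ z ∈ Ioo (y i.castSucc) (y i.succ), g.eval z = 0 := by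
    intro i
    have hlt : y i.castSucc < y i.succ := hy Fin.castSucc_lt_succ
    have h1 := hs i.castSucc
    have h2 := hs i.succ
    have e : n - (i : ℕ) = (n - ((i : ℕ) + 1)) + 1 := by omega
    simp only [Fin.val_castSucc, Fin.val_succ] at h1 h2
    rw [e, pow_succ] at h1
    have hc : ContinuousOn (fun t => g.eval t) (Icc (y i.castSucc) (y i.succ)) :=
      g.continuous.continuousOn
    rcases neg_one_pow_eq_or ℝ (n - ((i : ℕ) + 1)) with h | h <;> rw [h] at h1 h2
    · obtain ⟨z, hz, hz0⟩ := intermediate_value_Ioo hlt.le hc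
        (show (0 : ℝ) ∈ Ioo _ _ from ⟨by linarith, by linarith⟩)
      exact ⟨z, hz, hz0⟩
    · obtain ⟨z, hz, hz0⟩ := intermediate_value_Ioo' hlt.le hc
        (show (0 : ℝ) ∈ Ioo _ _ from ⟨by linarith, by linarith⟩)
      exact ⟨z, hz, hz0⟩
  choose x hx hx0 using key
  have hmono : StrictMono x := by
    intro i j hij
    have : i.succ ≤ j.castSucc := by
      rw [Fin.le_iff_val_le_val]; simpa using hij
    exact ((hx i).2.trans_le (hy.monotone this)).trans (hx j).1
  exact ⟨x, hmono, eq_nodal_of_roots hm hd hmono hx0⟩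

/-- The derivative at `x i` is the product of the differences `x i - x j`, and exactly the `n - 1 -
i` factors with `j > i` are negative. -/
theorem derivative_nodal_sign {n : ℕ} {x : Fin n → ℝ} (hx : StrictMono x) (i : Fin n) :
    0 < (-1 : ℝ) ^ (n - 1 - (i : ℕ)) * (derivative (nodal Finset.univ x)).eval (x i) := by
  rw [eval_nodal_derivative_eval_node_eq (Finset.mem_univ i), eval_nodal]
  have hu : (Finset.univ.erase i : Finset (Fin n)) = Finset.Iio i ∪ Finset.Ioi i := by
    ext j; simp [lt_or_lt_iff_ne]
  have hdj : Disjoint (Finset.Iio i) (Finset.Ioi i) := by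
    rw [Finset.disjoint_left]
    intro j hj hj'
    simp only [Finset.mem_Iio, Finset.mem_Ioi] at hj hj'
    exact lt_asymm hj hj'
  rw [hu, Finset.prod_union hdj, mul_left_comm, ← Fin.card_Ioi, ← Finset.prod_const,
    ← Finset.prod_mul_distrib]
  refine mul_pos (Finset.prod_pos fun j hj => ?_) (Finset.prod_pos fun j hj => ?_)
  · exact sub_pos.2 (hx (Finset.mem_Iio.1 hj))
  · have := hx (Finset.mem_Ioi.1 hj)
    linarith

theorem exists_gt_eval_pos {n : ℕ} {g : ℝ[X]} (hm : g.Monic) (hd : g.natDegree = n) (hn : 0 < n)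
    (B : ℝ) : ∃ y, B < y ∧ 0 < g.eval y := by
  have h := tendsto_atTop_of_leadingCoeff_nonneg g
    (natDegree_pos_iff_degree_pos.1 (hd ▸ hn)) (by rw [hm.leadingCoeff]; exact zero_le_one)
  obtain ⟨y, h1, h2⟩ := ((eventually_gt_atTop B).and (h.eventually_gt_atTop 0)).exists
  exact ⟨y, h1, h2⟩

theorem exists_lt_eval_sign {n : ℕ} {g : ℝ[X]} (hm : g.Monic) (hd : g.natDegree = n) (hn : 0 < n)
    (B : ℝ) : ∃ y, y < B ∧ 0 < (-1 : ℝ) ^ n * g.eval y := by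
  have hm' := hm.neg_one_pow_natDegree_mul_comp_neg_X
  rw [hd] at hm'
  have hd' : ((-1) ^ n * g.comp (-X)).natDegree = n := by
    have : ((-1 : ℝ[X]) ^ n) = C ((-1) ^ n) := by simp
    rw [this, natDegree_C_mul (by simp), natDegree_comp, hd]
    simp
  obtain ⟨y, h1, h2⟩ := exists_gt_eval_pos hm' hd' hn (-B)
  exact ⟨-y, by linarith, by simpa using h2⟩

theorem strictMono_snoc {n : ℕ} {x : Fin n → ℝ} (hx : StrictMono x) {t : ℝ} (ht : ∀ i, x i < t) :
    StrictMono (Fin.snoc x t : Fin (n + 1) → ℝ) := by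
  intro i j hij
  induction j using Fin.lastCases with
  | last =>
    induction i using Fin.lastCases with
    | last => exact absurd hij (lt_irrefl _)
    | cast i => simpa using ht i
  | cast j =>
    induction i using Fin.lastCases with
    | last => exact absurd hij (by simp [Fin.le_last])
    | cast i => simpa using hx (by simpa using hij)

theorem strictMono_cons {n : ℕ} {x : Fin n → ℝ} (hx : StrictMono x) {t : ℝ} (ht : ∀ i, t < x i) :
    StrictMono (Fin.cons t x : Fin (n + 1) → ℝ) := by
  intro i j hij
  induction j using Fin.cases with
  | zero => exact absurd hij (by simp)
  | succ j =>
    induction i using Fin.cases with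
    | zero => simpa using ht j
    | succ i => simpa using hx (by simpa using hij)

theorem exists_forall_lt {n : ℕ} (x : Fin n → ℝ) : ∃ B, ∀ i, x i < B := by
  obtain ⟨B, hB⟩ := (Set.finite_range x).bddAbove
  exact ⟨B + 1, fun i => by linarith [hB (mem_range_self i)]⟩

theorem exists_forall_gt {n : ℕ} (x : Fin n → ℝ) : ∃ B, ∀ i, B < x i := by
  obtain ⟨B, hB⟩ := (Set.finite_range x).bddBelow
  exact ⟨B - 1, fun i => by linarith [hB (mem_range_self i)]⟩

/-- `g ↦ g - a g'` preserves simple real-rootedness, `a > 0`. -/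
theorem HasSimpleRealRoots.sub_derivative_of_pos {n : ℕ} {g : ℝ[X]} (hg : HasSimpleRealRoots n g)
    (hn : 0 < n) {a : ℝ} (ha : 0 < a) : HasSimpleRealRoots n (g - C a * derivative g) := by
  have hdlt : (C a * derivative g).degree < g.degree := by
    rw [degree_C_mul ha.ne']
    exact degree_derivative_lt hg.monic.ne_zero
  have hm := hg.monic.sub_of_left hdlt
  have hd : (g - C a * derivative g).natDegree = n := by
    rw [natDegree_eq_of_degree_eq (degree_sub_eq_left_of_degree_lt hdlt), hg.natDegree]
  obtain ⟨x, hx, rfl⟩ := hg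
  obtain ⟨B, hB⟩ := exists_forall_lt x
  obtain ⟨t, ht, hpos⟩ := exists_gt_eval_pos hm hd hn B
  -- At a root of `g` the value is `-a g'`, whose sign alternates from root to root; the point `t`
  -- beyond the largest root supplies the last sign.
  refine hasSimpleRealRoots_of_alternating hm hd
    (strictMono_snoc hx fun i => (hB i).trans ht) fun (i : Fin (n + 1)) => ?_
  induction i using Fin.lastCases with
  | last => simpa using hpos
  | cast i =>
    have h := mul_pos ha (derivative_nodal_sign hx i)
    have e : n - (i : ℕ) = (n - 1 - (i : ℕ)) + 1 := by omega
    simp only [Fin.snoc_castSucc, Fin.val_castSucc, eval_sub, eval_mul, eval_C,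
      eval_nodal_at_node (Finset.mem_univ i)]
    rw [e, pow_succ]
    linarith

/-- `g ↦ g + a g'` preserves simple real-rootedness, `a > 0`. -/
theorem HasSimpleRealRoots.add_derivative_of_pos {n : ℕ} {g : ℝ[X]} (hg : HasSimpleRealRoots n g)
    (hn : 0 < n) {a : ℝ} (ha : 0 < a) : HasSimpleRealRoots n (g + C a * derivative g) := by
  have hdlt : (C a * derivative g).degree < g.degree := by
    rw [degree_C_mul ha.ne']
    exact degree_derivative_lt hg.monic.ne_zero
  have hm := hg.monic.add_of_left hdlt
  have hd : (g + C a * derivative g).natDegree = n := by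
    rw [natDegree_eq_of_degree_eq (degree_add_eq_left_of_degree_lt hdlt), hg.natDegree]
  obtain ⟨x, hx, rfl⟩ := hg
  obtain ⟨B, hB⟩ := exists_forall_gt x
  obtain ⟨t, ht, hpos⟩ := exists_lt_eval_sign hm hd hn B
  refine hasSimpleRealRoots_of_alternating hm hd
    (strictMono_cons hx fun i => ht.trans (hB i)) fun (i : Fin (n + 1)) => ?_
  induction i using Fin.cases with
  | zero => simpa using hpos
  | succ i =>
    have h := mul_pos ha (derivative_nodal_sign hx i)
    have e : n - ((i : ℕ) + 1) = n - 1 - (i : ℕ) := by omega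
    simp only [Fin.cons_succ, Fin.val_succ, eval_add, eval_mul, eval_C,
      eval_nodal_at_node (Finset.mem_univ i)]
    rw [e]
    linarith

/-- `g ↦ (1 - a²D²) g` preserves simple real-rootedness. -/
theorem HasSimpleRealRoots.sub_derivative_derivative {n : ℕ} {g : ℝ[X]}
    (hg : HasSimpleRealRoots n g) (hn : 0 < n) {a : ℝ} (ha : 0 ≤ a) :
    HasSimpleRealRoots n (g - C a * derivative (derivative g)) := by
  rcases ha.eq_or_lt with rfl | ha
  · simpa using hg
  -- Factor `1 - a D² = (1 + √a D) (1 - √a D)`.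
  have hb := Real.sqrt_pos.2 ha
  have h := (hg.sub_derivative_of_pos hn hb).add_derivative_of_pos hn hb
  convert h using 1
  have : C a = C (√a) * C (√a) := by rw [← C_mul, Real.mul_self_sqrt ha.le]
  rw [this]
  simp only [derivative_sub, derivative_C_mul]
  ring

/-- `g ↦ (x - r) g - b g'` raises the degree and preserves simple real-rootedness, `b > 0`. -/
theorem HasSimpleRealRoots.X_sub_C_mul_sub_derivative {n : ℕ} {g : ℝ[X]}
    (hg : HasSimpleRealRoots n g) (r : ℝ) {b : ℝ} (hb : 0 < b) :
    HasSimpleRealRoots (n + 1) ((X - C r) * g - C b * derivative g) := by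
  have hdX : ((X - C r) * g).degree = ((n + 1 : ℕ) : WithBot ℕ) := by
    rw [degree_mul, degree_X_sub_C,
      degree_eq_natDegree hg.monic.ne_zero, hg.natDegree]
    push_cast
    ring
  have hdlt : (C b * derivative g).degree < ((X - C r) * g).degree := by
    rw [degree_C_mul hb.ne', hdX]
    refine (degree_derivative_lt hg.monic.ne_zero).trans ?_
    rw [degree_eq_natDegree hg.monic.ne_zero, hg.natDegree]
    exact_mod_cast n.lt_succ_self
  have hm := ((monic_X_sub_C r).mul hg.monic).sub_of_left hdlt
  have hd : ((X - C r) * g - C b * derivative g).natDegree = n + 1 :=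
    natDegree_eq_of_degree_eq_some ((degree_sub_eq_left_of_degree_lt hdlt).trans hdX)
  obtain ⟨x, hx, rfl⟩ := hg
  obtain ⟨B, hB⟩ := exists_forall_lt x
  obtain ⟨B', hB'⟩ := exists_forall_gt x
  -- Taking the maximum ensures `t' < t` even when there are no roots in between.
  obtain ⟨t, ht, hpos⟩ := exists_gt_eval_pos hm hd n.succ_pos (max B B')
  obtain ⟨t', ht', hneg⟩ := exists_lt_eval_sign hm hd n.succ_pos B'
  have hmono := strictMono_snoc hx fun i => (hB i).trans ((le_max_left _ _).trans_lt ht)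
  refine hasSimpleRealRoots_of_alternating hm hd (strictMono_cons (t := t') hmono fun i => ?_)
    fun (i : Fin (n + 1 + 1)) => ?_
  · induction i using Fin.lastCases with
    | last => simpa using ht'.trans ((le_max_right _ _).trans_lt ht)
    | cast i => simpa using ht'.trans (hB' i)
  · induction i using Fin.cases with
    | zero => simpa using hneg
    | succ i =>
      induction i using Fin.lastCases with
      | last => simpa using hpos
      | cast i =>
        have h := mul_pos hb (derivative_nodal_sign hx i)
        have e : n + 1 - ((i : ℕ) + 1) = (n - 1 - (i : ℕ)) + 1 := by omega
        simp only [Fin.cons_succ, Fin.snoc_castSucc, Fin.val_succ, Fin.val_castSucc, eval_sub,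
          eval_mul, eval_C, eval_X, eval_nodal_at_node (Finset.mem_univ i)]
        rw [e, pow_succ]
        linarith

theorem hasSimpleRealRoots_one : HasSimpleRealRoots 0 1 :=
  ⟨Fin.elim0, fun i => i.elim0, by simp [nodal]⟩

end SimpleRealRoots

/-! ### The characteristic polynomial -/

/-- With `P = (x - u)² (x - v)² (x - c)`, the coefficients of
`x⁵ - (P - s P'' / 2 + (6 - m) s² P'''' / 24)`. -/
noncomputable def charCoeff (m u v c s : ℝ) : Fin 5 → ℝ :=
  let k4 := -2 * (u + v) - c
  let k3 := (u + v) ^ 2 + 2 * (u * v) + 2 * (u + v) * c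
  let k2 := -2 * (u + v) * (u * v) - c * ((u + v) ^ 2 + 2 * (u * v))
  let k1 := (u * v) ^ 2 + 2 * (u + v) * (u * v) * c
  let k0 := -c * (u * v) ^ 2
  ![-(k0 - s * k2 + (6 - m) * s ^ 2 * k4), -(k1 - 3 * s * k3 + 5 * (6 - m) * s ^ 2),
    -(k2 - 6 * s * k4), -(k3 - 10 * s), -k4]

section CharPoly

open Polynomial

/-- The polynomial with coefficients `c₀, …, c₅`. -/
noncomputable def quintic (c₀ c₁ c₂ c₃ c₄ c₅ : ℝ) : ℝ[X] :=
  C c₀ + C c₁ * X + C c₂ * X ^ 2 + C c₃ * X ^ 3 + C c₄ * X ^ 4 + C c₅ * X ^ 5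

theorem X_sub_C_mul_quintic_sub (r b c₀ c₁ c₂ c₃ c₄ : ℝ) :
    (X - C r) * quintic c₀ c₁ c₂ c₃ c₄ 0 - C b * derivative (quintic c₀ c₁ c₂ c₃ c₄ 0) =
      quintic (-r * c₀ - b * c₁) (c₀ - r * c₁ - 2 * b * c₂) (c₁ - r * c₂ - 3 * b * c₃)
        (c₂ - r * c₃ - 4 * b * c₄) (c₃ - r * c₄) c₄ := by
  unfold quintic
  simp only [derivative_add, derivative_C_mul, derivative_C, derivative_X, derivative_X_pow,
    C_0, C_sub, C_mul, C_neg, map_natCast, map_ofNat, derivative_zero, zero_mul]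
  push_cast
  ring

theorem quintic_sub_derivative_derivative_eval (a c₀ c₁ c₂ c₃ c₄ c₅ x : ℝ) :
    (quintic c₀ c₁ c₂ c₃ c₄ c₅ -
      C a * derivative (derivative (quintic c₀ c₁ c₂ c₃ c₄ c₅))).eval x =
      c₀ + c₁ * x + c₂ * x ^ 2 + c₃ * x ^ 3 + c₄ * x ^ 4 + c₅ * x ^ 5 -
        a * (2 * c₂ + 6 * c₃ * x + 12 * c₄ * x ^ 2 + 20 * c₅ * x ^ 3) := by
  unfold quintic
  simp only [derivative_add, derivative_C, derivative_X, derivative_X_pow,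
    derivative_one, derivative_zero, derivative_mul, eval_add, eval_sub, eval_mul, eval_C, eval_X, eval_pow,
    eval_zero, eval_one]
  push_cast
  ring

theorem HasSimpleRealRoots.quintic_step {n : ℕ} {c₀ c₁ c₂ c₃ c₄ : ℝ}
    (hg : HasSimpleRealRoots n (quintic c₀ c₁ c₂ c₃ c₄ 0)) (r : ℝ) {b : ℝ} (hb : 0 < b)
    {d₀ d₁ d₂ d₃ d₄ d₅ : ℝ} (h₀ : d₀ = -r * c₀ - b * c₁) (h₁ : d₁ = c₀ - r * c₁ - 2 * b * c₂)
    (h₂ : d₂ = c₁ - r * c₂ - 3 * b * c₃) (h₃ : d₃ = c₂ - r * c₃ - 4 * b * c₄)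
    (h₄ : d₄ = c₃ - r * c₄) (h₅ : d₅ = c₄) :
    HasSimpleRealRoots (n + 1) (quintic d₀ d₁ d₂ d₃ d₄ d₅) := by
  rw [h₀, h₁, h₂, h₃, h₄, h₅, ← X_sub_C_mul_quintic_sub]
  exact hg.X_sub_C_mul_sub_derivative r hb

/-- Since `exp(-b D²/2) ((x - r) g) = ((x - r) - b D) exp(-b D²/2) g`, the polynomial `exp(-b D²/2)
Q` is built from 1 by one step `g ↦ (x - r) g - b g'` per root `r` of `Q`, counted with
multiplicity. -/
theorem exists_charCoeff_roots {m : ℝ} (h3 : 3 ≤ m) (h6 : m < 6) (u v c : ℝ) {s : ℝ}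
    (hs : 0 < s) : ∃ x : Fin 5 → ℝ, StrictMono x ∧
      ∀ i, x i ^ 5 = ∑ j : Fin 5, charCoeff m u v c s j * x i ^ (j : ℕ) := by
  -- With `b = 2ts` and `a = (1/2 - t)s` the `D²` terms of `exp(-b D²/2) (1 - a D²)` already match;
  -- the `D⁴` terms match when `t(1 - t) = (6 - m)/12`. A root in `(0, 1/2]` exists exactly for `3 ≤
  -- m < 6`.
  obtain ⟨t, ht0, ht1, ht⟩ : ∃ t : ℝ, 0 < t ∧ t ≤ 1 / 2 ∧ t * (1 - t) = (6 - m) / 12 := by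
    have h0 : 0 ≤ (m - 3) / 3 := by linarith
    have h1 : √((m - 3) / 3) < 1 := by
      rw [Real.sqrt_lt' one_pos]; linarith
    have h2 := Real.sq_sqrt h0
    refine ⟨(1 - √((m - 3) / 3)) / 2, by linarith, by linarith [Real.sqrt_nonneg ((m - 3) / 3)], ?_⟩
    linear_combination -h2 / 4
  have hb : 0 < 2 * t * s := by positivity
  set b := 2 * t * s with hbdef
  have h1 := hasSimpleRealRoots_one
  rw [show (1 : ℝ[X]) = quintic 1 0 0 0 0 0 by simp [quintic]] at h1
  have h2 : HasSimpleRealRoots 1 (quintic (-u) 1 0 0 0 0) := by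
    apply h1.quintic_step u hb <;> ring
  have h3 : HasSimpleRealRoots 2 (quintic (u ^ 2 - b) (-2 * u) 1 0 0 0) := by
    apply h2.quintic_step u hb <;> ring
  have h4 : HasSimpleRealRoots 3 (quintic (-u ^ 2 * v + b * (2 * u + v))
      (u ^ 2 + 2 * u * v - 3 * b) (-(2 * u + v)) 1 0 0) := by
    apply h3.quintic_step v hb <;> ring
  have h5 : HasSimpleRealRoots 4 (quintic ((u * v) ^ 2 - b * ((u + v) ^ 2 + 2 * (u * v)) + 3 * b ^ 2)
      (-(2 * (u + v) * (u * v)) + 6 * b * (u + v)) ((u + v) ^ 2 + 2 * (u * v) - 6 * b)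
      (-2 * (u + v)) 1 0) := by
    apply h4.quintic_step v hb <;> ring
  let k4 := -2 * (u + v) - c
  let k3 := (u + v) ^ 2 + 2 * (u * v) + 2 * (u + v) * c
  let k2 := -2 * (u + v) * (u * v) - c * ((u + v) ^ 2 + 2 * (u * v))
  let k1 := (u * v) ^ 2 + 2 * (u + v) * (u * v) * c
  let k0 := -c * (u * v) ^ 2
  have h6 : HasSimpleRealRoots 5 (quintic (k0 - b * k2 + 3 * b ^ 2 * k4)
      (k1 - 3 * b * k3 + 15 * b ^ 2) (k2 - 6 * b * k4) (k3 - 10 * b) k4 1) := by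
    apply h5.quintic_step c hb <;> simp only [k0, k1, k2, k3, k4] <;> ring
  obtain ⟨x, hx, he⟩ := h6.sub_derivative_derivative (by norm_num)
    (show 0 ≤ (1 / 2 - t) * s from mul_nonneg (by linarith) hs.le)
  refine ⟨x, hx, fun i => ?_⟩
  have h0 := Lagrange.eval_nodal_at_node (v := x) (Finset.mem_univ i)
  rw [← he, quintic_sub_derivative_derivative_eval] at h0
  simp only [charCoeff, Fin.sum_univ_five, Matrix.cons_val]
  simp only [Fin.isValue, Fin.coe_ofNat_eq_mod, Nat.reduceMod, k0, k1, k2, k3, k4, hbdef] at h0 ⊢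
  generalize x i = y at h0 ⊢
  -- The factor multiplying `ht` is the fourth derivative of `Q`.
  linear_combination h0 - s ^ 2 / 2 * (120 * y + 24 * (-2 * (u + v) - c)) * ht

end CharPoly

/-! ### The moment map and its derivative -/

/-- The polynomial in `W` that gives the moment `M_j(W)`, `j ≤ 5`. -/
noncomputable def ansatzPoly (m : ℝ) (j : ℕ) (W : Fin 5 → ℝ) : ℝ :=
  W 0 * nodePoly m j (W 1) (W 4) + W 2 * nodePoly m j (W 3) (W 4)

theorem ansatzMoment_eq_ansatzPoly {K : ℝ → ℝ} (hK : IsNormalizedKernel K)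
    (heven : Function.Even K) {j : ℕ} (hj : j ≤ 5) {W : Fin 5 → ℝ} (hW : 0 < W 4) :
    ansatzMoment K W j = ansatzPoly (kernelMoment K 4) j W := by
  simp only [ansatzMoment, ansatzPoly, nodeMoment_eq_nodePoly_of_even hK heven hj _ hW]

theorem momentMap_apply_eq {K : ℝ → ℝ} (hK : IsNormalizedKernel K)
    (heven : Function.Even K) {W : Fin 5 → ℝ} (hW : 0 < W 4) (j : Fin 5) :
    momentMap K W j = ansatzPoly (kernelMoment K 4) j W :=
  ansatzMoment_eq_ansatzPoly hK heven (by omega) hW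

/-- `∂Δ_j/∂u`. -/
noncomputable def nodePolyDu (m : ℝ) (j : ℕ) (u σ : ℝ) : ℝ :=
  match j with
  | 0 => 0
  | 1 => 1
  | 2 => 2 * u
  | 3 => 3 * u ^ 2 + 3 * σ ^ 2
  | 4 => 4 * u ^ 3 + 12 * u * σ ^ 2
  | 5 => 5 * u ^ 4 + 30 * u ^ 2 * σ ^ 2 + 5 * m * σ ^ 4
  | _ => 0

/-- `∂Δ_j/∂σ`. -/
noncomputable def nodePolyDσ (m : ℝ) (j : ℕ) (u σ : ℝ) : ℝ :=
  match j with
  | 0 => 0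
  | 1 => 0
  | 2 => 2 * σ
  | 3 => 6 * u * σ
  | 4 => 12 * u ^ 2 * σ + 4 * m * σ ^ 3
  | 5 => 20 * u ^ 3 * σ + 20 * m * u * σ ^ 3
  | _ => 0

theorem HasStrictFDerivAt.nodePoly {E : Type*} [NormedAddCommGroup E] [NormedSpace ℝ E]
    {f g : E → ℝ} {f' g' : E →L[ℝ] ℝ} {x : E} (hf : HasStrictFDerivAt f f' x)
    (hg : HasStrictFDerivAt g g' x) (m : ℝ) {j : ℕ} (hj : j ≤ 5) :
    HasStrictFDerivAt (fun y => nodePoly m j (f y) (g y))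
      (nodePolyDu m j (f x) (g x) • f' + nodePolyDσ m j (f x) (g x) • g') x := by
  interval_cases j <;> simp only [_root_.nodePoly, nodePolyDu, nodePolyDσ]
  · simpa using hasStrictFDerivAt_const (1 : ℝ) x
  · simpa using hf
  · refine ((hf.pow 2).add (hg.pow 2)).congr_fderiv ?_
    ext; simp
  · refine ((hf.pow 3).add ((hf.const_mul 3).mul (hg.pow 2))).congr_fderiv ?_
    ext; simp; ring
  · refine (((hf.pow 4).add (((hf.pow 2).const_mul 6).mul (hg.pow 2))).add
      ((hg.pow 4).const_mul m)).congr_fderiv ?_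
    ext; simp; ring
  · refine (((hf.pow 5).add (((hf.pow 3).const_mul 10).mul (hg.pow 2))).add
      ((hf.const_mul (5 * m)).mul (hg.pow 4))).congr_fderiv ?_
    ext; simp; ring

/-- The partial derivatives of `M_j` with respect to `W`. -/
noncomputable def ansatzGrad (m : ℝ) (j : ℕ) (W : Fin 5 → ℝ) : Fin 5 → ℝ :=
  ![nodePoly m j (W 1) (W 4), W 0 * nodePolyDu m j (W 1) (W 4),
    nodePoly m j (W 3) (W 4), W 2 * nodePolyDu m j (W 3) (W 4),
    W 0 * nodePolyDσ m j (W 1) (W 4) + W 2 * nodePolyDσ m j (W 3) (W 4)]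

theorem hasStrictFDerivAt_ansatzPoly (m : ℝ) {j : ℕ} (hj : j ≤ 5) (W : Fin 5 → ℝ) :
    HasStrictFDerivAt (ansatzPoly m j)
      (∑ i, ansatzGrad m j W i • ContinuousLinearMap.proj (R := ℝ) (φ := fun _ : Fin 5 => ℝ) i)
      W := by
  have h : ∀ i : Fin 5, HasStrictFDerivAt (fun W : Fin 5 → ℝ => W i)
      (ContinuousLinearMap.proj (R := ℝ) (φ := fun _ : Fin 5 => ℝ) i) W :=
    fun i => hasStrictFDerivAt_apply i W
  refine (((h 0).mul ((h 1).nodePoly (h 4) m hj)).add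
    ((h 2).mul ((h 3).nodePoly (h 4) m hj))).congr_fderiv ?_
  ext
  simp [ansatzGrad, Fin.sum_univ_five]
  ring

/-- The Jacobian matrix of the moment map. -/
noncomputable def momentJacobian (m : ℝ) (W : Fin 5 → ℝ) : Matrix (Fin 5) (Fin 5) ℝ :=
  Matrix.of fun j => ansatzGrad m j W

/-- For `m ≥ 3` every factor is positive on `Ω`, so the moment map is locally invertible there. -/
theorem det_momentJacobian (m : ℝ) (W : Fin 5 → ℝ) :
    (momentJacobian m W).det = W 0 * W 2 * W 4 * (W 3 - W 1) ^ 4 * (W 0 + W 2) *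
      (2 * (W 3 - W 1) ^ 2 + 4 * (m - 3) * W 4 ^ 2) := by
  simp [momentJacobian, Matrix.det_succ_row_zero, Fin.sum_univ_succ, ansatzGrad, nodePoly,
    nodePolyDu, nodePolyDσ, Fin.succAbove]
  ring

/-! ### Uniqueness of the parameters -/

/-- The parameters of the two-node ansatz in terms of density, mean and centred nodes. -/
structure IsCentered (W : Fin 5 → ℝ) (ρ U x y : ℝ) : Prop where
  pos : 0 < ρ
  mass : W 0 + W 2 = ρ
  balance : W 0 * x + W 2 * y = 0
  left : W 1 = U + x
  right : W 3 = U + y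
  left_nonpos : x ≤ 0
  right_nonneg : 0 ≤ y
  left_eq_zero : x = 0 → y = 0
  right_eq_zero : y = 0 → x = 0

theorem exists_isCentered {W : Fin 5 → ℝ} (hW : W ∈ paramDomainTot) :
    ∃ ρ U x y, IsCentered W ρ U x y := by
  obtain ⟨h0, h2, h13, h4⟩ := hW
  have hρ : 0 < W 0 + W 2 := add_pos h0 h2
  have hx : W 1 - (W 0 * W 1 + W 2 * W 3) / (W 0 + W 2) = -(W 2 * (W 3 - W 1) / (W 0 + W 2)) := by
    field_simp; ring
  have hy : W 3 - (W 0 * W 1 + W 2 * W 3) / (W 0 + W 2) = W 0 * (W 3 - W 1) / (W 0 + W 2) := by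
    field_simp; ring
  have hd : 0 ≤ W 3 - W 1 := by linarith
  refine ⟨W 0 + W 2, (W 0 * W 1 + W 2 * W 3) / (W 0 + W 2), _, _, hρ, rfl, ?_,
    (add_sub_cancel _ _).symm, (add_sub_cancel _ _).symm, ?_, ?_, ?_, ?_⟩
  · field_simp; ring
  · rw [hx]; exact neg_nonpos.2 (by positivity)
  · rw [hy]; positivity
  · rw [hx, hy]
    intro h
    have : W 3 - W 1 = 0 := by simpa [h2.ne', hρ.ne'] using h
    simp [this]
  · rw [hx, hy]
    intro h
    have : W 3 - W 1 = 0 := by simpa [h0.ne', hρ.ne'] using h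
    simp [this]

namespace IsCentered

variable {W : Fin 5 → ℝ} {ρ U x y : ℝ} (h : IsCentered W ρ U x y) (m : ℝ)
include h

theorem moment_zero : ansatzPoly m 0 W = ρ := by
  simp only [ansatzPoly, nodePoly]
  linear_combination h.mass

theorem moment_one : ansatzPoly m 1 W = ρ * U := by
  simp only [ansatzPoly, nodePoly, h.left, h.right, ← h.mass]
  linear_combination h.balance

theorem moment_two : ansatzPoly m 2 W = ρ * (U ^ 2 + (-(x * y) + W 4 ^ 2)) := by
  simp only [ansatzPoly, nodePoly, h.left, h.right, ← h.mass]
  linear_combination (2 * U + (x + y)) * h.balance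

theorem moment_three : ansatzPoly m 3 W =
    ρ * (U ^ 3 + 3 * U * (-(x * y) + W 4 ^ 2) + (x + y) * -(x * y)) := by
  simp only [ansatzPoly, nodePoly, h.left, h.right, ← h.mass]
  linear_combination
    (3 * U ^ 2 + 3 * U * (x + y) + ((x + y) ^ 2 - x * y) + 3 * W 4 ^ 2) * h.balance

theorem moment_four : ansatzPoly m 4 W =
    ρ * (U ^ 4 + 6 * U ^ 2 * (-(x * y) + W 4 ^ 2) + 4 * U * ((x + y) * -(x * y)) +
      ((x * y) ^ 2 + (x + y) ^ 2 * -(x * y) + 6 * W 4 ^ 2 * -(x * y) + m * W 4 ^ 4)) := by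
  simp only [ansatzPoly, nodePoly, h.left, h.right, ← h.mass]
  linear_combination (4 * U ^ 3 + 6 * U ^ 2 * (x + y) + 4 * U * ((x + y) ^ 2 - x * y) +
    ((x + y) ^ 3 - 2 * (x + y) * (x * y)) + 6 * W 4 ^ 2 * (2 * U + (x + y))) * h.balance

theorem variance_nonneg : 0 ≤ -(x * y) := by
  nlinarith [mul_nonneg (neg_nonneg.2 h.left_nonpos) h.right_nonneg]

end IsCentered

/-- Here `E` is the node variance, `s = σ²`, and `a * E` the third central moment. Suppose `E > E'`.
For fixed `q = a E` the term `a² E = q²/E` does not increase with `E`, while with `E + s` fixed `E²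
+ 6sE + m s²` strictly decreases, the gap being `h6`. So the fourth moments cannot agree. -/
theorem variance_le {m E E' s s' a a' : ℝ} (h3 : 3 ≤ m) (hE' : 0 ≤ E') (hs : 0 < s)
    (hs' : 0 < s') (h2 : E + s = E' + s') (hq : a * E = a' * E')
    (h4 : E ^ 2 + a ^ 2 * E + 6 * s * E + m * s ^ 2 =
      E' ^ 2 + a' ^ 2 * E' + 6 * s' * E' + m * s' ^ 2) : E ≤ E' := by
  by_contra! hlt
  have hE : 0 < E := hE'.trans_lt hlt
  have h5 : a ^ 2 * E ≤ a' ^ 2 * E' := by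
    refine le_of_mul_le_mul_right ?_ hE
    have : a ^ 2 * E * E = a' ^ 2 * E' * E' := by linear_combination (a * E + a' * E') * hq
    rw [this]
    exact mul_le_mul_of_nonneg_left hlt.le (by positivity)
  obtain rfl : s' = E + s - E' := by linarith
  have h6 : 0 < (E - E') * ((m - 3) * (s + (E + s - E')) + 2 * (E + E')) :=
    mul_pos (by linarith) (add_pos_of_nonneg_of_pos
      (mul_nonneg (by linarith) (by linarith)) (by linarith))
  nlinarith

theorem parameters_unique {m : ℝ} (h3 : 3 ≤ m) {W W' : Fin 5 → ℝ} (hW : W ∈ paramDomainTot)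
    (hW' : W' ∈ paramDomainTot)
    (h : ∀ j : Fin 5, ansatzPoly m j W = ansatzPoly m j W') :
    W 1 = W' 1 ∧ W 3 = W' 3 ∧ W 4 = W' 4 ∧ W 0 + W 2 = W' 0 + W' 2 ∧
      W 0 * W 1 + W 2 * W 3 = W' 0 * W' 1 + W' 2 * W' 3 := by
  obtain ⟨ρ, U, x, y, hc⟩ := exists_isCentered hW
  obtain ⟨ρ', U', x', y', hc'⟩ := exists_isCentered hW'
  have hρ := hc.pos.ne'
  have h0 : ρ = ρ' := by
    have := h 0
    rwa [show ((0 : Fin 5) : ℕ) = 0 from rfl, hc.moment_zero, hc'.moment_zero] at this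
  subst h0
  have h1 : U = U' := by
    have := h 1
    rw [show ((1 : Fin 5) : ℕ) = 1 from rfl, hc.moment_one, hc'.moment_one] at this
    exact mul_left_cancel₀ hρ this
  subst h1
  have h2 : -(x * y) + W 4 ^ 2 = -(x' * y') + W' 4 ^ 2 := by
    have := h 2
    rw [show ((2 : Fin 5) : ℕ) = 2 from rfl, hc.moment_two, hc'.moment_two] at this
    linarith [mul_left_cancel₀ hρ this]
  have hq : (x + y) * -(x * y) = (x' + y') * -(x' * y') := by
    have := h 3
    rw [show ((3 : Fin 5) : ℕ) = 3 from rfl, hc.moment_three, hc'.moment_three, h2] at this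
    linarith [mul_left_cancel₀ hρ this]
  have h4 : (x * y) ^ 2 + (x + y) ^ 2 * -(x * y) + 6 * W 4 ^ 2 * -(x * y) + m * W 4 ^ 4 =
      (x' * y') ^ 2 + (x' + y') ^ 2 * -(x' * y') + 6 * W' 4 ^ 2 * -(x' * y') + m * W' 4 ^ 4 := by
    have := h 4
    rw [show ((4 : Fin 5) : ℕ) = 4 from rfl, hc.moment_four, hc'.moment_four, h2, hq] at this
    linarith [mul_left_cancel₀ hρ this]
  have hs : 0 < W 4 ^ 2 := pow_pos hW.2.2.2 2
  have hs' : 0 < W' 4 ^ 2 := pow_pos hW'.2.2.2 2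
  have hE : x * y = x' * y' := by
    have e1 := variance_le h3 hc'.variance_nonneg hs hs' h2 hq (by linear_combination h4)
    have e2 := variance_le h3 hc.variance_nonneg hs' hs h2.symm hq.symm (by linear_combination -h4)
    linarith
  have hσ : W 4 = W' 4 := by
    refine (pow_left_inj₀ hW.2.2.2.le hW'.2.2.2.le two_ne_zero).1 ?_
    linarith
  have hxy : x = x' ∧ y = y' := by
    -- Zero variance means both nodes sit at the mean; otherwise the sum and product of the centred
    -- nodes are known, and their signs order them.
    by_cases hx : x * y = 0
    · have hz : ∀ {V : Fin 5 → ℝ} {x y : ℝ}, IsCentered V ρ U x y → x * y = 0 → x = 0 ∧ y = 0 := by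
        intro V x y hV h0
        rcases mul_eq_zero.1 h0 with h | h
        · exact ⟨h, hV.left_eq_zero h⟩
        · exact ⟨hV.right_eq_zero h, h⟩
      obtain ⟨rfl, rfl⟩ := hz hc hx
      obtain ⟨rfl, rfl⟩ := hz hc' (hE ▸ hx)
      exact ⟨rfl, rfl⟩
    · have ha : x + y = x' + y' := by
        rw [hE] at hq
        exact mul_right_cancel₀ (neg_ne_zero.2 (hE ▸ hx)) hq
      have hx0 : x < 0 := lt_of_le_of_ne hc.left_nonpos (left_ne_zero_of_mul hx)
      have hr : (x - x') * (x - y') = 0 := by linear_combination x * ha - hE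
      rcases mul_eq_zero.1 hr with e | e
      · exact ⟨by linarith, by linarith⟩
      · linarith [hc'.right_nonneg]
  obtain ⟨rfl, rfl⟩ := hxy
  refine ⟨by rw [hc.left, hc'.left], by rw [hc.right, hc'.right], hσ, by rw [hc.mass, hc'.mass], ?_⟩
  rw [hc.left, hc.right, hc'.left, hc'.right]
  linear_combination U * (hc.mass.trans hc'.mass.symm) + hc.balance - hc'.balance

theorem paramDomain_subset : paramDomain ⊆ paramDomainTot :=
  fun _ h => ⟨h.1, h.2.1, h.2.2.1.le, h.2.2.2⟩

section

variable {K : ℝ → ℝ} (hK : IsNormalizedKernel K) (heven : Function.Even K)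
  (h3 : 3 ≤ kernelMoment K 4)
include hK heven h3

theorem parameters_unique_of_momentMap_eq {W W' : Fin 5 → ℝ} (hW : W ∈ paramDomainTot)
    (hW' : W' ∈ paramDomainTot) (h : momentMap K W = momentMap K W') :
    W 1 = W' 1 ∧ W 3 = W' 3 ∧ W 4 = W' 4 ∧ W 0 + W 2 = W' 0 + W' 2 ∧
      W 0 * W 1 + W 2 * W 3 = W' 0 * W' 1 + W' 2 * W' 3 := by
  refine parameters_unique h3 hW hW' fun j => ?_
  rw [← momentMap_apply_eq hK heven hW.2.2.2, ← momentMap_apply_eq hK heven hW'.2.2.2, h]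

theorem injOn_momentMap : InjOn (momentMap K) paramDomain := by
  intro W hW W' hW' h
  obtain ⟨e1, e3, e4, e02, eN⟩ := parameters_unique_of_momentMap_eq hK heven h3
    (paramDomain_subset hW) (paramDomain_subset hW') h
  have hd : W 3 - W 1 ≠ 0 := (sub_pos.2 hW.2.2.1).ne'
  rw [← e1, ← e3] at eN
  have e2 : W 2 = W' 2 := by
    refine mul_right_cancel₀ hd ?_
    linear_combination eN - W 1 * e02
  have e0 : W 0 = W' 0 := by linarith
  funext i
  fin_cases i <;> assumption

/-- When the nodes coincide only the sum of the weights can be recovered, but then the fifth moment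
depends on nothing more. -/
theorem closingMoment_momentMap {W : Fin 5 → ℝ} (hW : W ∈ paramDomainTot) :
    closingMoment K (momentMap K W) = ansatzMoment K W 5 := by
  have hex : ∃ V ∈ paramDomainTot, momentMap K V = momentMap K W := ⟨W, hW, rfl⟩
  have hV := Function.invFunOn_mem hex
  have he := Function.invFunOn_eq hex
  unfold closingMoment
  generalize Function.invFunOn (momentMap K) paramDomainTot (momentMap K W) = V at hV he
  obtain ⟨e1, e3, e4, e02, eN⟩ := parameters_unique_of_momentMap_eq hK heven h3 hV hW he
  rw [ansatzMoment_eq_ansatzPoly hK heven le_rfl hV.2.2.2,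
    ansatzMoment_eq_ansatzPoly hK heven le_rfl hW.2.2.2]
  unfold ansatzPoly
  rw [e1, e3, e4]
  rw [e1, e3] at eN
  rcases hW.2.2.1.eq_or_lt with h | h
  · rw [← h, ← add_mul, ← add_mul, e02]
  · have hd : W 3 - W 1 ≠ 0 := (sub_pos.2 h).ne'
    have e2 : V 2 = W 2 := by
      refine mul_right_cancel₀ hd ?_
      linear_combination eN - W 1 * e02
    have e0 : V 0 = W 0 := by linarith
    rw [e0, e2]

end

/-! ### The closing coefficients -/

/-- The fifth root of the auxiliary polynomial `(x - u₁)² (x - u₂)² (x - c)`. -/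
noncomputable def auxRoot (m : ℝ) (W : Fin 5 → ℝ) : ℝ :=
  (W 0 * W 1 + W 2 * W 3) / (W 0 + W 2) -
    4 * (m - 3) * W 4 ^ 2 * (W 1 + W 3 - 2 * ((W 0 * W 1 + W 2 * W 3) / (W 0 + W 2))) /
      ((W 3 - W 1) ^ 2 + 2 * (m - 3) * W 4 ^ 2)

/-- The closing coefficients in terms of the parameters. -/
noncomputable def paramCoeff (m : ℝ) (W : Fin 5 → ℝ) : Fin 5 → ℝ :=
  charCoeff m (W 1) (W 3) (auxRoot m W) (W 4 ^ 2)

/-- The weight and node identities express that the averaged polynomial vanishes to second order at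
each node, whatever `c` is. The width identity is a single linear equation for `c`, which `auxRoot`
solves. -/
theorem paramCoeff_mul_grad {m : ℝ} (h3 : 3 ≤ m) {W : Fin 5 → ℝ} (hW : W ∈ paramDomain)
    (i : Fin 5) :
    ∑ j : Fin 5, paramCoeff m W j * ansatzGrad m j W i = ansatzGrad m 5 W i := by
  have hN : W 0 + W 2 ≠ 0 := (add_pos hW.1 hW.2.1).ne'
  have hh : (W 3 - W 1) ^ 2 + 2 * (m - 3) * W 4 ^ 2 ≠ 0 :=
    (add_pos_of_pos_of_nonneg (pow_pos (sub_pos.2 hW.2.2.1) 2)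
      (mul_nonneg (by linarith) (sq_nonneg _))).ne'
  have hc : auxRoot m W * ((W 0 + W 2) * ((W 3 - W 1) ^ 2 + 2 * (m - 3) * W 4 ^ 2)) =
      (W 0 * W 1 + W 2 * W 3) * ((W 3 - W 1) ^ 2 + 10 * (m - 3) * W 4 ^ 2) -
        4 * (m - 3) * W 4 ^ 2 * (W 1 + W 3) * (W 0 + W 2) := by
    unfold auxRoot
    generalize hD : (W 3 - W 1) ^ 2 + 2 * (m - 3) * W 4 ^ 2 = D at hh ⊢
    field_simp
    rw [← hD]
    ring
  unfold paramCoeff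
  generalize auxRoot m W = c at hc
  simp only [charCoeff, Fin.sum_univ_five, ansatzGrad]
  fin_cases i <;> simp [nodePoly, nodePolyDu, nodePolyDσ]
  · ring
  · ring
  · ring
  · ring
  · linear_combination 2 * W 4 * hc

theorem paramDomain_isOpen : IsOpen paramDomain := by
  have h : ∀ i : Fin 5, Continuous fun W : Fin 5 → ℝ => W i := continuous_apply
  exact (isOpen_lt continuous_const (h 0)).inter ((isOpen_lt continuous_const (h 2)).inter
    ((isOpen_lt (h 1) (h 3)).inter (isOpen_lt continuous_const (h 4))))

section

variable {K : ℝ → ℝ} (hK : IsNormalizedKernel K) (heven : Function.Even K)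
  (h3 : 3 ≤ kernelMoment K 4)
include hK heven h3

theorem differentiableAt_closingMoment {W : Fin 5 → ℝ} (hW : W ∈ paramDomain) :
    DifferentiableAt ℝ (closingMoment K) (momentMap K W) ∧
      closingGradient K (momentMap K W) = paramCoeff (kernelMoment K 4) W := by
  set m := kernelMoment K 4
  have hdet : (momentJacobian m W).det ≠ 0 := by
    rw [det_momentJacobian]
    have h1 := hW.1
    have h2 := hW.2.1
    have h4 := hW.2.2.2
    have hd : 0 < W 3 - W 1 := sub_pos.2 hW.2.2.1
    have h5 : 0 ≤ m - 3 := by linarith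
    positivity
  let J : (Fin 5 → ℝ) ≃L[ℝ] (Fin 5 → ℝ) :=
    (Matrix.toLinearEquiv' (momentJacobian m W)
      ((Matrix.isUnit_iff_isUnit_det _).2 (isUnit_iff_ne_zero.2 hdet)).invertible
      ).toContinuousLinearEquiv
  have hJ : ∀ v, J v = (momentJacobian m W).mulVec v := fun v => rfl
  let Φ : (Fin 5 → ℝ) → (Fin 5 → ℝ) := fun W j => ansatzPoly m j W
  have hΦ : HasStrictFDerivAt Φ (J : (Fin 5 → ℝ) →L[ℝ] (Fin 5 → ℝ)) W := by
    refine hasStrictFDerivAt_pi'.2 fun j =>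
      (hasStrictFDerivAt_ansatzPoly m (by omega : (j : ℕ) ≤ 5) W).congr_fderiv ?_
    ext v
    simp [hJ, Matrix.mulVec, dotProduct, momentJacobian]
  have heq : ∀ V ∈ paramDomain, momentMap K V = Φ V := fun V hV =>
    funext fun j => momentMap_apply_eq hK heven hV.2.2.2 j
  have hinv := hΦ.to_localInverse
  have hmem : ∀ᶠ M in 𝓝 (Φ W), hΦ.localInverse Φ J W M ∈ paramDomain := by
    have : Tendsto (hΦ.localInverse Φ J W) (𝓝 (Φ W)) (𝓝 W) := by
      have := hinv.hasFDerivAt.continuousAt.tendsto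
      rwa [hΦ.localInverse_apply_image] at this
    exact this (paramDomain_isOpen.mem_nhds hW)
  -- The preimage chosen in `closingMoment` is replaced by the smooth local inverse.
  have hclose : closingMoment K =ᶠ[𝓝 (Φ W)]
      fun M => ansatzPoly m 5 (hΦ.localInverse Φ J W M) := by
    filter_upwards [hmem, hΦ.eventually_right_inverse] with M hM hr
    rw [← ansatzMoment_eq_ansatzPoly hK heven le_rfl hM.2.2.2,
      ← closingMoment_momentMap hK heven h3 (paramDomain_subset hM), heq _ hM, hr]
  have hg : HasFDerivAt (ansatzPoly m 5)
      (∑ i, ansatzGrad m 5 W i • ContinuousLinearMap.proj (R := ℝ) (φ := fun _ : Fin 5 => ℝ) i)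
      (hΦ.localInverse Φ J W (Φ W)) := by
    rw [hΦ.localInverse_apply_image]
    exact (hasStrictFDerivAt_ansatzPoly m le_rfl W).hasFDerivAt
  have hd := (hg.comp (Φ W) hinv.hasFDerivAt).congr_of_eventuallyEq hclose
  rw [heq W hW]
  refine ⟨hd.differentiableAt, funext fun j => ?_⟩
  simp only [closingGradient, hd.fderiv]
  obtain ⟨v, hv⟩ := J.surjective (Pi.single j 1)
  have hv' : ∀ k : Fin 5, ∑ i, ansatzGrad m k W i * v i = (Pi.single j 1 : Fin 5 → ℝ) k := fun k => by
    rw [← hv, hJ]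
    simp [Matrix.mulVec, dotProduct, momentJacobian]
  rw [← hv]
  simp only [ContinuousLinearMap.comp_apply, ContinuousLinearEquiv.coe_coe,
    ContinuousLinearEquiv.symm_apply_apply, sum_apply,
    smul_apply, ContinuousLinearMap.proj_apply, smul_eq_mul]
  calc ∑ i, ansatzGrad m 5 W i * v i
      = ∑ i, (∑ k : Fin 5, paramCoeff m W k * ansatzGrad m k W i) * v i := by
        simp only [paramCoeff_mul_grad h3 hW]
    _ = ∑ k : Fin 5, paramCoeff m W k * ∑ i, ansatzGrad m k W i * v i := by
        simp only [Finset.sum_mul, Finset.mul_sum, mul_assoc]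
        exact Finset.sum_comm
    _ = paramCoeff m W j := by simp [hv', Pi.single_apply]

end

theorem continuousAt_auxRoot {m : ℝ} (h3 : 3 ≤ m) {W : Fin 5 → ℝ} (hW : W ∈ paramDomainTot) :
    ContinuousAt (auxRoot m) W := by
  have h : ∀ i : Fin 5, ContinuousAt (fun W : Fin 5 → ℝ => W i) W :=
    fun i => (continuous_apply i).continuousAt
  have hU : ContinuousAt (fun W : Fin 5 → ℝ => (W 0 * W 1 + W 2 * W 3) / (W 0 + W 2)) W :=
    (((h 0).mul (h 1)).add ((h 2).mul (h 3))).div ((h 0).add (h 2)) (add_pos hW.1 hW.2.1).ne'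
  -- For `m = 3` the denominator vanishes at coinciding nodes, but the numerator carries the factor
  -- `m - 3`, so the correction term is identically zero.
  rcases h3.eq_or_lt with rfl | h3
  · have : auxRoot 3 = fun W : Fin 5 → ℝ => (W 0 * W 1 + W 2 * W 3) / (W 0 + W 2) := by
      funext W; simp [auxRoot]
    rw [this]
    exact hU
  · unfold auxRoot
    refine hU.sub (ContinuousAt.div ?_ ?_ ?_)
    · exact (((h 4).pow 2).const_mul (4 * (m - 3))).mul
        (((h 1).add (h 3)).sub (hU.const_mul 2))
    · exact (((h 3).sub (h 1)).pow 2).add (((h 4).pow 2).const_mul (2 * (m - 3)))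
    · have h1 : 0 < m - 3 := sub_pos.2 h3
      have h2 := hW.2.2.2
      positivity

theorem continuousAt_paramCoeff {m : ℝ} (h3 : 3 ≤ m) {W : Fin 5 → ℝ}
    (hW : W ∈ paramDomainTot) : ContinuousAt (paramCoeff m) W := by
  have h1 : ContinuousAt (fun W : Fin 5 → ℝ => W 1) W := (continuous_apply 1).continuousAt
  have h2 : ContinuousAt (fun W : Fin 5 → ℝ => W 3) W := (continuous_apply 3).continuousAt
  have h4 : ContinuousAt (fun W : Fin 5 → ℝ => W 4) W := (continuous_apply 4).continuousAt
  have hc := continuousAt_auxRoot h3 hW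
  have hp : Continuous fun q : ℝ × ℝ × ℝ × ℝ => charCoeff m q.1 q.2.1 q.2.2.1 (q.2.2.2 ^ 2) := by
    refine continuous_pi fun i => ?_
    simp only [charCoeff]
    fin_cases i <;> simp <;> fun_prop
  exact ContinuousAt.comp (f := fun W : Fin 5 → ℝ => (W 1, W 3, auxRoot m W, W 4))
    hp.continuousAt (h1.prodMk (h2.prodMk (hc.prodMk h4)))

/-- Makes the coefficients at coinciding nodes independent of how the mass is split between the two
weights. -/
theorem auxRoot_of_eq (m : ℝ) {W : Fin 5 → ℝ} (hW : W ∈ paramDomainTot) (h : W 1 = W 3) :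
    auxRoot m W = W 1 := by
  have hN : W 0 + W 2 ≠ 0 := (add_pos hW.1 hW.2.1).ne'
  have hU : (W 0 * W 1 + W 2 * W 3) / (W 0 + W 2) = W 1 := by
    rw [← h]; field_simp
  rw [auxRoot, hU, ← h]
  ring

/-- Needed for the limit defining `closingCoeff` to be unique; the right node is moved slightly to
the right. -/
theorem neBot_nhdsWithin_paramDomain {W : Fin 5 → ℝ} (hW : W ∈ paramDomainTot) :
    (𝓝[paramDomain] W).NeBot := by
  rw [← mem_closure_iff_nhdsWithin_neBot]
  have ht : Tendsto (fun t : ℝ => Function.update W 3 (W 3 + t)) (𝓝[>] 0) (𝓝 W) := by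
    have : Continuous fun t : ℝ => Function.update W 3 (W 3 + t) := by fun_prop
    have h := this.tendsto 0
    rw [add_zero, Function.update_eq_self] at h
    exact h.mono_left nhdsWithin_le_nhds
  refine mem_closure_of_tendsto ht ?_
  filter_upwards [self_mem_nhdsWithin] with t ht
  have ht : 0 < t := ht
  obtain ⟨h0, h2, h13, h4⟩ := hW
  exact ⟨by simpa, by simpa, by simpa using by linarith, by simpa⟩

section

variable {K : ℝ → ℝ} (hK : IsNormalizedKernel K) (heven : Function.Even K)
  (h3 : 3 ≤ kernelMoment K 4)
include hK heven h3

theorem tendsto_closingGradient {W : Fin 5 → ℝ} (hW : W ∈ paramDomainTot) :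
    Tendsto (fun W' => closingGradient K (momentMap K W')) (𝓝[paramDomain] W)
      (𝓝 (paramCoeff (kernelMoment K 4) W)) := by
  refine ((continuousAt_paramCoeff h3 hW).tendsto.mono_left nhdsWithin_le_nhds).congr' ?_
  filter_upwards [self_mem_nhdsWithin] with W' hW'
  exact (differentiableAt_closingMoment hK heven h3 hW').2.symm

theorem closingCoeff_momentMap {W : Fin 5 → ℝ} (hW : W ∈ paramDomainTot) :
    closingCoeff K (momentMap K W) = paramCoeff (kernelMoment K 4) W := by
  rcases hW.2.2.1.eq_or_lt with h | h
  · have hn : momentMap K W ∉ momentMap K '' paramDomain := by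
      rintro ⟨V, hV, he⟩
      obtain ⟨e1, e3, -⟩ := parameters_unique_of_momentMap_eq hK heven h3
        (paramDomain_subset hV) hW he
      exact hV.2.2.1.ne (by rw [e1, e3, h])
    have hex : ∃ V ∈ paramDomainTot, momentMap K V = momentMap K W := ⟨W, hW, rfl⟩
    have hV := Function.invFunOn_mem hex
    have he := Function.invFunOn_eq hex
    rw [closingCoeff, if_neg hn]
    generalize Function.invFunOn (momentMap K) paramDomainTot (momentMap K W) = V at hV he
    have := neBot_nhdsWithin_paramDomain hV
    rw [(tendsto_closingGradient hK heven h3 hV).limUnder_eq]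
    -- The chosen preimage `V` may have other weights than `W`; only its nodes and width enter the
    -- limit.
    obtain ⟨e1, e3, e4, -⟩ := parameters_unique_of_momentMap_eq hK heven h3 hV hW he
    rw [paramCoeff, paramCoeff, auxRoot_of_eq _ hW h, auxRoot_of_eq _ hV (by rw [e1, e3, h]),
      e1, e3, e4]
  · have hW' : W ∈ paramDomain := ⟨hW.1, hW.2.1, h, hW.2.2.2⟩
    rw [closingCoeff, if_pos ⟨W, hW', rfl⟩]
    exact (differentiableAt_closingMoment hK heven h3 hW').2

end

/-! ### The source term -/

/-- The coefficients of `(ξ - U)³ - 3 θ (ξ - U)`. -/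
def hermiteThree (U θ : ℝ) : Fin 5 → ℝ :=
  ![-U ^ 3 + 3 * U * θ, 3 * U ^ 2 - 3 * θ, -3 * U, 1, 0]

/-- The coefficients of `(ξ - U)⁴ - 6 θ (ξ - U)² + 3 θ²`. -/
def hermiteFour (U θ : ℝ) : Fin 5 → ℝ :=
  ![U ^ 4 - 6 * θ * U ^ 2 + 3 * θ ^ 2, -4 * U ^ 3 + 12 * θ * U, 6 * U ^ 2 - 6 * θ, -4 * U, 1]

/-- The Jacobian of the source in terms of mean velocity and temperature. -/
noncomputable def sourceJacobian (τ U θ : ℝ) : Matrix (Fin 5) (Fin 5) ℝ :=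
  -(1 / τ) • Matrix.of ![0, 0, 0, hermiteThree U θ, hermiteFour U θ + (4 * U) • hermiteThree U θ]

theorem bgkSource_eq (τ : ℝ) {M : Fin 5 → ℝ} (h0 : 0 < M 0) (hθ : 0 < temperature M) :
    bgkSource τ M = ![0, 0, 0, (1 / τ) * (3 * M 1 * M 2 / M 0 - 2 * M 1 ^ 3 / M 0 ^ 2 - M 3),
      (1 / τ) * (3 * M 2 ^ 2 / M 0 - 2 * M 1 ^ 4 / M 0 ^ 3 - M 4)] := by
  have hs := Real.sqrt_pos.2 hθ
  have hsq := Real.sq_sqrt hθ.le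
  have h0' := h0.ne'
  funext j
  rw [bgkSource, gaussMoment_eq_nodePoly (by omega) _ hs]
  generalize √(temperature M) = w at hsq
  have h4 : w ^ 4 = temperature M ^ 2 := by rw [← hsq]; ring
  fin_cases j <;> simp only [nodePoly, hsq, h4] <;> simp [temperature, meanVelocity] <;>
    field_simp <;> ring_nf
  all_goals simp

theorem hasFDerivAt_bgkSource (τ : ℝ) {M : Fin 5 → ℝ} (h0 : 0 < M 0) (hθ : 0 < temperature M) :
    HasFDerivAt (bgkSource τ)
      (Matrix.mulVecLin (sourceJacobian τ (meanVelocity M) (temperature M))).toContinuousLinearMap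
      M := by
  have h : ∀ i : Fin 5, HasFDerivAt (fun M : Fin 5 → ℝ => M i)
      (ContinuousLinearMap.proj (R := ℝ) (φ := fun _ : Fin 5 => ℝ) i) M :=
    fun i => hasFDerivAt_apply i M
  have h0' := h0.ne'
  -- The closed form needs positive density and temperature, which persist near `M`.
  have hev : ∀ᶠ N in 𝓝 M, bgkSource τ N =
      ![0, 0, 0, (1 / τ) * (3 * N 1 * N 2 * (N 0)⁻¹ - 2 * N 1 ^ 3 * (N 0)⁻¹ ^ 2 - N 3),
        (1 / τ) * (3 * N 2 ^ 2 * (N 0)⁻¹ - 2 * N 1 ^ 4 * (N 0)⁻¹ ^ 3 - N 4)] := by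
    have hc : ContinuousAt temperature M := by
      unfold temperature meanVelocity
      exact ((h 2).continuousAt.div (h 0).continuousAt h0').sub
        (((h 1).continuousAt.div (h 0).continuousAt h0').pow 2)
    filter_upwards [(h 0).continuousAt.eventually (lt_mem_nhds h0),
      hc.eventually (lt_mem_nhds hθ)] with N h1 h2
    rw [bgkSource_eq τ h1 h2]
    simp only [div_eq_mul_inv, inv_pow]
  refine HasFDerivAt.congr_of_eventuallyEq ?_ hev
  have hi : HasFDerivAt (fun N : Fin 5 → ℝ => (N 0)⁻¹) _ M := (hasFDerivAt_inv h0').comp M (h 0)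
  refine hasFDerivAt_pi'.2 fun j => ?_
  fin_cases j
  · refine (hasFDerivAt_const (0 : ℝ) M).congr_fderiv ?_
    ext v; simp [sourceJacobian, dotProduct]
  · refine (hasFDerivAt_const (0 : ℝ) M).congr_fderiv ?_
    ext v; simp [sourceJacobian, dotProduct]
  · refine (hasFDerivAt_const (0 : ℝ) M).congr_fderiv ?_
    ext v; simp [sourceJacobian, dotProduct]
  · refine ((((((h 1).const_mul 3).mul (h 2)).mul hi).sub
      ((((h 1).pow 3).const_mul 2).mul (hi.pow 2))).sub (h 3)).const_mul (1 / τ)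
      |>.congr_fderiv ?_
    ext v
    simp [sourceJacobian, dotProduct, Fin.sum_univ_five, hermiteThree,
      temperature, meanVelocity]
    field_simp
    ring
  · refine (((((h 2).pow 2).const_mul 3).mul hi).sub
      ((((h 1).pow 4).const_mul 2).mul (hi.pow 3))).sub (h 4)|>.const_mul (1 / τ)
      |>.congr_fderiv ?_
    ext v
    simp [sourceJacobian, dotProduct, Fin.sum_univ_five, hermiteThree,
      hermiteFour, temperature, meanVelocity]
    field_simp
    ring

theorem jacobianMatrix_bgkSource (τ : ℝ) {M : Fin 5 → ℝ} (h0 : 0 < M 0)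
    (hθ : 0 < temperature M) :
    jacobianMatrix (bgkSource τ) M = sourceJacobian τ (meanVelocity M) (temperature M) := by
  ext i j
  simp [jacobianMatrix, (hasFDerivAt_bgkSource τ h0 hθ).fderiv]

namespace IsCentered

variable {K : ℝ → ℝ} (hK : IsNormalizedKernel K) (heven : Function.Even K)
  {W : Fin 5 → ℝ} {ρ U x y : ℝ} (h : IsCentered W ρ U x y) (hσ : 0 < W 4)
include hK heven h hσ

theorem momentMap_zero : momentMap K W 0 = ρ := by
  rw [momentMap_apply_eq hK heven hσ, ← h.moment_zero (kernelMoment K 4)]; rfl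

theorem meanVelocity_eq : meanVelocity (momentMap K W) = U := by
  rw [meanVelocity, h.momentMap_zero hK heven hσ, momentMap_apply_eq hK heven hσ,
    show ((1 : Fin 5) : ℕ) = 1 from rfl, h.moment_one]
  exact mul_div_cancel_left₀ U h.pos.ne'

theorem temperature_eq : temperature (momentMap K W) = -(x * y) + W 4 ^ 2 := by
  rw [temperature, h.meanVelocity_eq hK heven hσ, h.momentMap_zero hK heven hσ,
    momentMap_apply_eq hK heven hσ, show ((2 : Fin 5) : ℕ) = 2 from rfl, h.moment_two,
    mul_div_cancel_left₀ _ h.pos.ne']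
  ring

theorem temperature_pos : 0 < temperature (momentMap K W) := by
  rw [h.temperature_eq hK heven hσ]
  exact add_pos_of_nonneg_of_pos h.variance_nonneg (pow_pos hσ 2)

/-- The Gaussian shares `ρ`, `U`, `θ` with the state, so only orders three and four matter: the
third central moment must vanish and the fourth must equal `3θ²`. -/
theorem bgkSource_eq_zero_iff {τ : ℝ} (hτ : 0 < τ) :
    bgkSource τ (momentMap K W) = 0 ↔ (x + y) * -(x * y) = 0 ∧
      2 * (x * y) ^ 2 = (kernelMoment K 4 - 3) * W 4 ^ 4 + (x + y) ^ 2 * -(x * y) := by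
  have hρ := h.pos
  have e0 := h.momentMap_zero hK heven hσ
  have e1 := (momentMap_apply_eq hK heven hσ 1).trans (h.moment_one _)
  have e2 := (momentMap_apply_eq hK heven hσ 2).trans (h.moment_two _)
  have e3 := (momentMap_apply_eq hK heven hσ 3).trans (h.moment_three _)
  have e4 := (momentMap_apply_eq hK heven hσ 4).trans (h.moment_four _)
  rw [bgkSource_eq τ (by rw [e0]; exact hρ) (h.temperature_pos hK heven hσ), e0, e1, e2, e3, e4]
  have a3 : 1 / τ * (3 * (ρ * U) * (ρ * (U ^ 2 + (-(x * y) + W 4 ^ 2))) / ρ -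
      2 * (ρ * U) ^ 3 / ρ ^ 2 -
      ρ * (U ^ 3 + 3 * U * (-(x * y) + W 4 ^ 2) + (x + y) * -(x * y))) =
      -(ρ / τ) * ((x + y) * -(x * y)) := by
    field_simp; ring
  have a4 : 1 / τ * (3 * (ρ * (U ^ 2 + (-(x * y) + W 4 ^ 2))) ^ 2 / ρ -
      2 * (ρ * U) ^ 4 / ρ ^ 3 -
      ρ * (U ^ 4 + 6 * U ^ 2 * (-(x * y) + W 4 ^ 2) + 4 * U * ((x + y) * -(x * y)) +
      ((x * y) ^ 2 + (x + y) ^ 2 * -(x * y) + 6 * W 4 ^ 2 * -(x * y) +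
        kernelMoment K 4 * W 4 ^ 4))) =
      (ρ / τ) * (2 * (x * y) ^ 2 - (kernelMoment K 4 - 3) * W 4 ^ 4 - (x + y) ^ 2 * -(x * y)) -
        4 * U * (ρ / τ) * ((x + y) * -(x * y)) := by
    field_simp; ring
  rw [a3, a4]
  have hc : ρ / τ ≠ 0 := (div_pos hρ hτ).ne'
  constructor
  · intro hz
    have z3 := congrFun hz 3
    have z4 := congrFun hz 4
    simp only [Matrix.cons_val, Pi.zero_apply] at z3 z4
    have y3 : (x + y) * -(x * y) = 0 := (mul_eq_zero.1 z3).resolve_left (neg_ne_zero.2 hc)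
    rw [y3, mul_zero, sub_zero] at z4
    exact ⟨y3, by linarith [(mul_eq_zero.1 z4).resolve_left hc]⟩
  · rintro ⟨y3, y4⟩
    rw [y3, y4]
    funext j
    fin_cases j <;> simp

end IsCentered

/-! ### Symmetrizers -/

theorem posDef_transpose_mul_diagonal_mul {n : Type*} [Fintype n] [DecidableEq n]
    {L : Matrix n n ℝ} (hL : IsUnit L) {d : n → ℝ} (hd : ∀ i, 0 < d i) :
    (L.transpose * Matrix.diagonal d * L).PosDef := by
  have h := (Matrix.PosDef.diagonal hd).conjTranspose_mul_mul_same
    (Matrix.mulVec_injective_of_isUnit hL)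
  rwa [Matrix.conjTranspose_eq_transpose_of_trivial] at h

theorem symmetrizes_of_mul_eq {n : Type*} [Fintype n] [DecidableEq n]
    {A L T D : Matrix n n ℝ} (hLA : L * A = T * L) (hT : D * T = T.transpose * D) :
    (L.transpose * D * L) * A = A.transpose * (L.transpose * D * L) := by
  calc (L.transpose * D * L) * A = L.transpose * (D * T) * L := by
        rw [Matrix.mul_assoc, hLA]; simp only [Matrix.mul_assoc]
    _ = (T * L).transpose * D * L := by
        rw [hT, Matrix.transpose_mul]; simp only [Matrix.mul_assoc]
    _ = A.transpose * (L.transpose * D * L) := by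
        rw [← hLA, Matrix.transpose_mul]; simp only [Matrix.mul_assoc]

/-- The matrix with ones on the superdiagonal and last row `a`. -/
def companionMatrix (a : Fin 5 → ℝ) : Matrix (Fin 5) (Fin 5) ℝ :=
  Matrix.of fun i j => if i = 4 then a j else if (j : ℕ) = (i : ℕ) + 1 then 1 else 0

theorem coeffMatrix_eq (K : ℝ → ℝ) (M : Fin 5 → ℝ) :
    coeffMatrix K M = companionMatrix (closingCoeff K M) := rfl

/-- The vectors `(1, x, …, x⁴)` at the roots are right eigenvectors of the companion matrix. Hence
`V⁻¹` diagonalizes it and `(V⁻¹)ᵀ V⁻¹` symmetrizes it. -/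
theorem exists_symmetrizer_of_roots {a x : Fin 5 → ℝ} (hx : StrictMono x)
    (h : ∀ i, x i ^ 5 = ∑ j : Fin 5, a j * x i ^ (j : ℕ)) :
    ∃ A₀ : Matrix (Fin 5) (Fin 5) ℝ, A₀.PosDef ∧
      A₀ * companionMatrix a = (companionMatrix a).transpose * A₀ := by
  set V := (Matrix.vandermonde x).transpose
  have hV : IsUnit V.det := by
    rw [Matrix.det_transpose]
    exact isUnit_iff_ne_zero.2 (Matrix.det_vandermonde_ne_zero_iff.2 hx.injective)
  have hAV : companionMatrix a * V = V * Matrix.diagonal x := by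
    ext i k
    have hk := h k
    rw [Fin.sum_univ_five] at hk
    fin_cases i <;>
      simp [companionMatrix, V, Matrix.mul_apply, Fin.sum_univ_five, Matrix.vandermonde_apply,
        Matrix.diagonal_apply] at hk ⊢
    all_goals first | linear_combination -hk | ring1
  have hLA : V⁻¹ * companionMatrix a = Matrix.diagonal x * V⁻¹ := by
    calc V⁻¹ * companionMatrix a = V⁻¹ * (companionMatrix a * V) * V⁻¹ := by
          rw [Matrix.mul_assoc, Matrix.mul_assoc, Matrix.mul_nonsing_inv V hV, Matrix.mul_one]
      _ = Matrix.diagonal x * V⁻¹ := by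
          rw [hAV, ← Matrix.mul_assoc, Matrix.nonsing_inv_mul V hV, Matrix.one_mul]
  refine ⟨_, posDef_transpose_mul_diagonal_mul (L := V⁻¹) (d := fun _ => 1)
    ((Matrix.isUnit_iff_isUnit_det _).2 (Matrix.isUnit_nonsing_inv_det V hV))
    (fun _ => one_pos), symmetrizes_of_mul_eq hLA ?_⟩
  rw [Matrix.diagonal_transpose, Matrix.diagonal_mul_diagonal, Matrix.diagonal_mul_diagonal]
  simp [mul_comm]

/-! ### Block matrices and the equilibrium clauses -/

theorem lowerBlock_mul {N r : ℕ} (hr : r ≤ N) (S T : Matrix (Fin r) (Fin r) ℝ) :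
    lowerBlock hr S * lowerBlock hr T = lowerBlock hr (S * T) := by
  simp only [lowerBlock, Matrix.reindex_apply]
  rw [Matrix.submatrix_mul_equiv, Matrix.fromBlocks_multiply]
  simp

theorem lowerBlock_smul {N r : ℕ} (hr : r ≤ N) (c : ℝ) (T : Matrix (Fin r) (Fin r) ℝ) :
    lowerBlock hr (c • T) = c • lowerBlock hr T := by
  ext i j
  simp only [lowerBlock, Matrix.reindex_apply, Matrix.submatrix_apply, Matrix.smul_apply]
  rw [← Matrix.smul_apply, Matrix.fromBlocks_smul]
  simp

theorem lowerBlock_one_five_two (hr : 2 ≤ 5) :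
    lowerBlock hr (1 : Matrix (Fin 2) (Fin 2) ℝ) = Matrix.diagonal ![0, 0, 0, 1, 1] := by
  ext i j
  fin_cases i <;> fin_cases j <;> rfl

/-- Clauses (I) and (III) force the kernel of the source Jacobian to be orthogonal to its range
with respect to the symmetrizer. -/
theorem transpose_mulVec_eq_zero_of_clauses {N r : ℕ} (hr : r ≤ N)
    {P J A₀ : Matrix (Fin N) (Fin N) ℝ} {T : Matrix (Fin r) (Fin r) ℝ}
    (hP : IsUnit P) (hT : IsUnit T) (hJ : P * J * P⁻¹ = lowerBlock hr T)
    (hN : (-(P.transpose * lowerBlock hr (1 : Matrix (Fin r) (Fin r) ℝ) * P) -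
        (A₀ * J + J.transpose * A₀)).PosSemidef) {v : Fin N → ℝ} (hv : J.mulVec v = 0) :
    J.transpose.mulVec (A₀.mulVec v) = 0 := by
  have hPd := (Matrix.isUnit_iff_isUnit_det P).1 hP
  have hTd := (Matrix.isUnit_iff_isUnit_det T).1 hT
  -- As `T` is invertible, the dissipative part of `P v` is a function of `J v`, so it vanishes on
  -- the kernel of `J`.
  have h1 : lowerBlock hr (1 : Matrix (Fin r) (Fin r) ℝ) * P = lowerBlock hr T⁻¹ * P * J := by
    rw [← Matrix.nonsing_inv_mul T hTd, ← lowerBlock_mul, ← hJ]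
    simp only [Matrix.mul_assoc, Matrix.nonsing_inv_mul P hPd, Matrix.mul_one]
  have h2 : (lowerBlock hr (1 : Matrix (Fin r) (Fin r) ℝ) * P).mulVec v = 0 := by
    rw [h1, ← Matrix.mulVec_mulVec, hv, Matrix.mulVec_zero]
  have h3 : (-(P.transpose * lowerBlock hr (1 : Matrix (Fin r) (Fin r) ℝ) * P) -
      (A₀ * J + J.transpose * A₀)).mulVec v = -(J.transpose.mulVec (A₀.mulVec v)) := by
    rw [Matrix.sub_mulVec, Matrix.neg_mulVec, Matrix.mul_assoc, ← Matrix.mulVec_mulVec, h2,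
      Matrix.add_mulVec, ← Matrix.mulVec_mulVec, hv, ← Matrix.mulVec_mulVec]
    simp
  -- A semidefinite form that vanishes at `v` has `v` in its kernel.
  have h4 := (hN.dotProduct_mulVec_zero_iff v).1 (by
    rw [h3, star_trivial, dotProduct_neg, Matrix.mulVec_transpose, dotProduct_comm,
      ← Matrix.dotProduct_mulVec, hv, dotProduct_zero, neg_zero])
  rw [h3] at h4
  exact neg_eq_zero.1 h4

/-! ### The equilibrium symmetrizer -/

/-- The closing coefficients at an equilibrium: those of
`ξ⁵ - ((ξ - U)⁵ - α (ξ - U)³ + β (ξ - U))` for `α = 10 θ - 8 E`, `β = 15 θ² - 24 E θ`. -/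
def equilibriumCoeff (U θ E : ℝ) : Fin 5 → ℝ :=
  ![U ^ 5 - (10 * θ - 8 * E) * U ^ 3 + (15 * θ ^ 2 - 24 * E * θ) * U,
    -5 * U ^ 4 + 3 * (10 * θ - 8 * E) * U ^ 2 - (15 * θ ^ 2 - 24 * E * θ),
    10 * U ^ 3 - 3 * (10 * θ - 8 * E) * U, -10 * U ^ 2 + (10 * θ - 8 * E), 5 * U]

/-- The coefficients of the Hermite polynomials of degree at most four. -/
def hermiteMatrix (U θ : ℝ) : Matrix (Fin 5) (Fin 5) ℝ :=
  Matrix.of ![![1, 0, 0, 0, 0], ![-U, 1, 0, 0, 0], ![U ^ 2 - θ, -2 * U, 1, 0, 0],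
    hermiteThree U θ, hermiteFour U θ]

/-- The recurrence matrix of the Hermite polynomials, closed at an equilibrium. -/
def recurrenceMatrix (U θ E : ℝ) : Matrix (Fin 5) (Fin 5) ℝ :=
  !![U, 1, 0, 0, 0; θ, U, 1, 0, 0; 0, 2 * θ, U, 1, 0; 0, 0, 3 * θ, U, 1;
    0, 0, 0, 4 * θ - 8 * E, U]

theorem isUnit_hermiteMatrix (U θ : ℝ) : IsUnit (hermiteMatrix U θ) := by
  rw [Matrix.isUnit_iff_isUnit_det]
  have : (hermiteMatrix U θ).det = 1 := by
    simp [hermiteMatrix, hermiteThree, hermiteFour, Matrix.det_succ_row_zero, Fin.sum_univ_succ,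
      Fin.succAbove]
  rw [this]
  exact isUnit_one

/-- On rows of coefficients the companion matrix acts as multiplication by `ξ` modulo the
characteristic polynomial. The Hermite recurrence holds up to degree 3, and reducing `ξ H₄` leaves
`U H₄ + (4θ - 8E) H₃`. -/
theorem hermiteMatrix_mul_companionMatrix (U θ E : ℝ) :
    hermiteMatrix U θ * companionMatrix (equilibriumCoeff U θ E) =
      recurrenceMatrix U θ E * hermiteMatrix U θ := by
  ext i j
  fin_cases i <;> fin_cases j <;>
    simp [hermiteMatrix, companionMatrix, equilibriumCoeff, recurrenceMatrix, hermiteThree,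
      hermiteFour, Matrix.mul_apply, Fin.sum_univ_five] <;> ring

/-- `H₀, H₁, H₂` test conserved quantities, while `H₃, H₄` are left eigenvectors with eigenvalue
`-1/τ`. -/
theorem hermiteMatrix_mul_sourceJacobian (τ U θ : ℝ) :
    hermiteMatrix U θ * sourceJacobian τ U θ =
      -(1 / τ) • (Matrix.diagonal ![0, 0, 0, 1, 1] * hermiteMatrix U θ) := by
  ext i j
  fin_cases i <;> fin_cases j <;>
    simp [hermiteMatrix, sourceJacobian, hermiteThree, hermiteFour, Matrix.mul_apply,
      Fin.sum_univ_five] <;> ring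

/-- The weights of the equilibrium symmetrizer. -/
noncomputable def hermiteWeight (c θ E : ℝ) : Fin 5 → ℝ :=
  ![c, c / θ, c / (2 * θ ^ 2), c / (6 * θ ^ 3), c / (6 * θ ^ 3 * (4 * θ - 8 * E))]

/-- A tridiagonal matrix is symmetrized by diagonal weights whose successive ratios balance the
off-diagonal pairs. -/
theorem diagonal_hermiteWeight_mul_recurrenceMatrix (c U : ℝ) {θ E : ℝ} (hθ : 0 < θ)
    (hE : 0 < 4 * θ - 8 * E) :
    Matrix.diagonal (hermiteWeight c θ E) * recurrenceMatrix U θ E =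
      (recurrenceMatrix U θ E).transpose * Matrix.diagonal (hermiteWeight c θ E) := by
  have h1 := hθ.ne'
  have h2 := hE.ne'
  unfold hermiteWeight recurrenceMatrix
  generalize 4 * θ - 8 * E = k at h2
  ext i j
  rw [Matrix.diagonal_mul, Matrix.mul_diagonal, Matrix.transpose_apply]
  fin_cases i <;> fin_cases j <;> simp <;> field_simp <;> ring

theorem exists_equilibrium_symmetrizer {τ : ℝ} (hτ : 0 < τ) (U : ℝ) {θ E : ℝ} (hθ : 0 < θ)
    (hE : 0 < 4 * θ - 8 * E) :
    ∃ A₀ : Matrix (Fin 5) (Fin 5) ℝ, A₀.PosDef ∧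
      A₀ * companionMatrix (equilibriumCoeff U θ E) =
        (companionMatrix (equilibriumCoeff U θ E)).transpose * A₀ ∧
      (-((hermiteMatrix U θ).transpose * Matrix.diagonal ![0, 0, 0, 1, 1] * hermiteMatrix U θ) -
        (A₀ * sourceJacobian τ U θ + (sourceJacobian τ U θ).transpose * A₀)).PosSemidef := by
  set L := hermiteMatrix U θ
  -- This scale makes the last two weights `τ(1 + k)` and `τ(1 + 1/k)` with `k = 4θ - 8E`; both
  -- exceed `τ/2`, as (III) requires.
  set c := τ * (6 * θ ^ 3 + 6 * θ ^ 3 * (4 * θ - 8 * E))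
  have hc : 0 < c := by positivity
  have hw : ∀ i, 0 < hermiteWeight c θ E i := by
    intro i
    fin_cases i <;> simp [hermiteWeight] <;> positivity
  refine ⟨_, posDef_transpose_mul_diagonal_mul (isUnit_hermiteMatrix U θ) hw,
    symmetrizes_of_mul_eq (hermiteMatrix_mul_companionMatrix U θ E)
      (diagonal_hermiteWeight_mul_recurrenceMatrix c U hθ hE), ?_⟩
  set D := Matrix.diagonal (hermiteWeight c θ E)
  set Q : Matrix (Fin 5) (Fin 5) ℝ := Matrix.diagonal ![0, 0, 0, 1, 1]
  have hL : L * sourceJacobian τ U θ = -(1 / τ) • (Q * L) :=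
    hermiteMatrix_mul_sourceJacobian τ U θ
  have e1 : L.transpose * D * L * sourceJacobian τ U θ = -(1 / τ) • (L.transpose * (D * Q) * L) := by
    rw [Matrix.mul_assoc, hL, Matrix.mul_smul]
    simp only [Matrix.mul_assoc]
  have e2 : (sourceJacobian τ U θ).transpose * (L.transpose * D * L) =
      -(1 / τ) • (L.transpose * (D * Q) * L) := by
    have := congrArg Matrix.transpose e1
    simp only [Matrix.transpose_mul, Matrix.transpose_smul, Matrix.transpose_transpose, D, Q,
      Matrix.diagonal_transpose] at this ⊢
    rw [(Matrix.commute_diagonal _ _).eq] at this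
    simpa only [Matrix.mul_assoc] using this
  have e3 : -(L.transpose * Q * L) - (L.transpose * D * L * sourceJacobian τ U θ +
      (sourceJacobian τ U θ).transpose * (L.transpose * D * L)) =
      L.transpose * ((2 / τ) • (D * Q) - Q) * L := by
    rw [e1, e2, Matrix.mul_sub, Matrix.sub_mul, Matrix.mul_smul, Matrix.smul_mul]
    module
  rw [e3]
  have hd : (2 / τ) • (D * Q) - Q =
      Matrix.diagonal ![0, 0, 0, 2 / τ * hermiteWeight c θ E 3 - 1,
        2 / τ * hermiteWeight c θ E 4 - 1] := by
    rw [Matrix.diagonal_mul_diagonal, ← Matrix.diagonal_smul, Matrix.diagonal_sub]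
    congr 1
    funext i
    fin_cases i <;> simp
  have hps : (Matrix.diagonal ![0, 0, 0, 2 / τ * hermiteWeight c θ E 3 - 1,
        2 / τ * hermiteWeight c θ E 4 - 1] : Matrix (Fin 5) (Fin 5) ℝ).PosSemidef := by
    refine Matrix.PosSemidef.diagonal fun i => ?_
    have p3 : 0 < 6 * θ ^ 3 := by positivity
    have w3 : hermiteWeight c θ E 3 = τ * (1 + (4 * θ - 8 * E)) := by
      simp only [hermiteWeight, c, Matrix.cons_val]; field_simp
    have w4 : hermiteWeight c θ E 4 = τ * (1 + (4 * θ - 8 * E)⁻¹) := by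
      have hE' := hE.ne'
      simp only [hermiteWeight, c, Matrix.cons_val]
      generalize 4 * θ - 8 * E = k at hE'
      field_simp
      ring
    have i4 := inv_pos.2 hE
    rw [w3, w4, ← mul_assoc, ← mul_assoc, div_mul_cancel₀ _ hτ.ne']
    fin_cases i <;> simp <;> linarith
  rw [hd]
  have := hps.conjTranspose_mul_mul_same L
  rwa [Matrix.conjTranspose_eq_transpose_of_trivial] at this

/-! ### Equilibria -/

/-- Nodes symmetric about `U` force `c = U`; the relation `2E² = (m - 3)σ⁴` then eliminates `m`. -/
theorem IsCentered.paramCoeff_of_equilibrium {m : ℝ} (h3 : 3 ≤ m) {W : Fin 5 → ℝ} {ρ U x y : ℝ}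
    (h : IsCentered W ρ U x y) (hxy : x + y = 0)
    (hE : -(x * y) = √((m - 3) / 2) * W 4 ^ 2) :
    paramCoeff (m) W = equilibriumCoeff U (-(x * y) + W 4 ^ 2) (-(x * y)) := by
  have hr := Real.sq_sqrt (show 0 ≤ (m - 3) / 2 by linarith)
  obtain rfl : y = -x := by linarith
  have hN : W 0 + W 2 ≠ 0 := by rw [h.mass]; exact h.pos.ne'
  have hU : (W 0 * W 1 + W 2 * W 3) / (W 0 + W 2) = U := by
    rw [div_eq_iff hN, h.left, h.right]
    linear_combination h.balance
  have hc : auxRoot (m) W = U := by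
    rw [auxRoot, hU, h.left, h.right]
    ring
  have hq : 2 * (x ^ 2) ^ 2 = (m - 3) * W 4 ^ 4 := by
    linear_combination 2 * (x ^ 2 + √((m - 3) / 2) * W 4 ^ 2) * hE +
      2 * W 4 ^ 4 * hr
  rw [paramCoeff, hc, h.left, h.right]
  funext i
  fin_cases i <;> simp [charCoeff, equilibriumCoeff]
  · linear_combination 5 * U * hq
  · linear_combination -5 * hq
  all_goals ring

section

variable {K : ℝ → ℝ} (hK : IsNormalizedKernel K) (heven : Function.Even K)
  (h3 : 3 ≤ kernelMoment K 4)
include hK heven h3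

theorem IsCentered.equilibrium_iff {W : Fin 5 → ℝ} {ρ U x y : ℝ} (h : IsCentered W ρ U x y)
    (hσ : 0 < W 4) {τ : ℝ} (hτ : 0 < τ) :
    bgkSource τ (momentMap K W) = 0 ↔
      x + y = 0 ∧ -(x * y) = √((kernelMoment K 4 - 3) / 2) * W 4 ^ 2 := by
  have hr := Real.sq_sqrt (show 0 ≤ (kernelMoment K 4 - 3) / 2 by linarith)
  rw [h.bgkSource_eq_zero_iff hK heven hσ hτ]
  constructor
  · rintro ⟨h1, h2⟩
    have hxy : x + y = 0 := by
      rcases mul_eq_zero.1 h1 with h0 | h0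
      · exact h0
      · rcases mul_eq_zero.1 (neg_eq_zero.1 h0) with h0 | h0
        · rw [h0, h.left_eq_zero h0, add_zero]
        · rw [h0, h.right_eq_zero h0, add_zero]
    refine ⟨hxy, (pow_left_inj₀ h.variance_nonneg (by positivity) two_ne_zero).1 ?_⟩
    rw [hxy] at h2
    linear_combination h2 / 2 - W 4 ^ 4 * hr
  · rintro ⟨h1, h2⟩
    refine ⟨by rw [h1, zero_mul], ?_⟩
    rw [h1]
    linear_combination 2 * (-(x * y) + √((kernelMoment K 4 - 3) / 2) * W 4 ^ 2) * h2 +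
      2 * W 4 ^ 4 * hr

/-- The parameters of an equilibrium with unit density, zero mean and unit width. -/
theorem exists_equilibrium {τ : ℝ} (hτ : 0 < τ) : ∃ W ∈ paramDomainTot, ∃ x y,
    IsCentered W 1 0 x y ∧ W 4 = 1 ∧ bgkSource τ (momentMap K W) = 0 := by
  set r := √((kernelMoment K 4 - 3) / 2)
  have hr : 0 ≤ r := Real.sqrt_nonneg _
  have hq := Real.sqrt_nonneg r
  have hc : IsCentered ![1 / 2, -√r, 1 / 2, √r, 1] 1 0 (-√r) (√r) := by
    refine ⟨one_pos, ?_, ?_, ?_, ?_, ?_, hq, ?_, ?_⟩ <;> simp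
    · norm_num
  refine ⟨![1 / 2, -√r, 1 / 2, √r, 1], ⟨by simp, by simp, ?_, by simp⟩, _, _, hc, by simp, ?_⟩
  · simp
  · rw [hc.equilibrium_iff hK heven h3 (by simp) hτ]
    refine ⟨neg_add_cancel _, ?_⟩
    rw [neg_mul, neg_neg, Real.mul_self_sqrt hr]
    simp [r]

theorem isWellDefinedSystem {τ : ℝ} (hτ : 0 < τ) : IsWellDefinedSystem K τ where
  injOn := injOn_momentMap hK heven h3
  closing _ hW := closingMoment_momentMap hK heven h3 hW
  differentiable _ hW := (differentiableAt_closingMoment hK heven h3 hW).1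
  tendsto W hW _ := by
    rw [closingCoeff_momentMap hK heven h3 hW]
    exact tendsto_closingGradient hK heven h3 hW
  source := by
    rintro _ ⟨W, hW, rfl⟩
    obtain ⟨ρ, U, x, y, h⟩ := exists_isCentered hW
    exact (hasFDerivAt_bgkSource τ (by rw [h.momentMap_zero hK heven hW.2.2.2]; exact h.pos)
      (h.temperature_pos hK heven hW.2.2.2)).differentiableAt
  equilibrium := by
    obtain ⟨W, hW, -, -, -, -, h⟩ := exists_equilibrium hK heven h3 hτ
    exact ⟨_, ⟨W, hW, rfl⟩, h⟩

theorem coeffMatrix_momentMap {W : Fin 5 → ℝ} (hW : W ∈ paramDomainTot) :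
    coeffMatrix K (momentMap K W) = companionMatrix (paramCoeff (kernelMoment K 4) W) := by
  rw [coeffMatrix_eq, closingCoeff_momentMap hK heven h3 hW]

theorem structuralStability_of_lt (h5 : kernelMoment K 4 < 5) {τ : ℝ} (hτ : 0 < τ) :
    StructuralStability (stateSpace K) (coeffMatrix K) (bgkSource τ) := by
  have hr1 : √((kernelMoment K 4 - 3) / 2) < 1 := by
    rw [Real.sqrt_lt' one_pos]; linarith
  let P : (Fin 5 → ℝ) → Matrix (Fin 5) (Fin 5) ℝ :=
    fun M => hermiteMatrix (meanVelocity M) (temperature M)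
  have key : ∀ M, ∃ A₀ : Matrix (Fin 5) (Fin 5) ℝ, M ∈ stateSpace K →
      A₀.PosDef ∧ A₀ * coeffMatrix K M = (coeffMatrix K M).transpose * A₀ ∧
      (M ∈ equilibria (stateSpace K) (bgkSource τ) →
        (-((P M).transpose * Matrix.diagonal ![0, 0, 0, 1, 1] * P M) -
          (A₀ * jacobianMatrix (bgkSource τ) M +
            (jacobianMatrix (bgkSource τ) M).transpose * A₀)).PosSemidef) := by
    intro M
    by_cases hM : M ∈ stateSpace K
    swap
    · exact ⟨0, fun h => absurd h hM⟩
    obtain ⟨W, hW, rfl⟩ := hM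
    obtain ⟨ρ, U, x, y, h⟩ := exists_isCentered hW
    have hσ := hW.2.2.2
    -- No continuity of `A₀` is required, so the Hermite symmetrizer is used at equilibria and the
    -- Vandermonde one elsewhere.
    by_cases he : momentMap K W ∈ equilibria (stateSpace K) (bgkSource τ)
    · obtain ⟨hxy, hE⟩ := (h.equilibrium_iff hK heven h3 hσ hτ).1 he.2
      have hθ := h.temperature_pos hK heven hσ
      rw [h.temperature_eq hK heven hσ] at hθ
      obtain ⟨A₀, h1, h2, h4⟩ := exists_equilibrium_symmetrizer hτ U hθ (E := -(x * y)) (by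
        have := mul_pos (sub_pos.2 hr1) (pow_pos hσ 2)
        rw [hE]
        linarith)
      refine ⟨A₀, fun _ => ⟨h1, ?_, fun _ => ?_⟩⟩
      · rwa [coeffMatrix_momentMap hK heven h3 hW,
          h.paramCoeff_of_equilibrium h3 hxy hE]
      · simp only [P]
        rwa [jacobianMatrix_bgkSource τ (by rw [h.momentMap_zero hK heven hσ]; exact h.pos)
          (h.temperature_pos hK heven hσ), h.meanVelocity_eq hK heven hσ,
          h.temperature_eq hK heven hσ]
    · obtain ⟨z, hz, hroot⟩ := exists_charCoeff_roots h3 (by linarith) (W 1) (W 3)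
        (auxRoot (kernelMoment K 4) W) (pow_pos hσ 2)
      obtain ⟨A₀, h1, h2⟩ := exists_symmetrizer_of_roots hz hroot
      refine ⟨A₀, fun _ => ⟨h1, ?_, fun h => absurd h he⟩⟩
      rw [coeffMatrix_momentMap hK heven h3 hW]
      exact h2
  choose A₀ hA₀ using key
  refine ⟨2, two_pos, by norm_num, P, fun _ => (-(1 / τ)) • 1, A₀, ?_, ?_, ?_⟩
  · rintro _ ⟨⟨W, hW, rfl⟩, -⟩
    obtain ⟨ρ, U, x, y, h⟩ := exists_isCentered hW
    have hσ := hW.2.2.2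
    have hP : IsUnit (P (momentMap K W)) := isUnit_hermiteMatrix _ _
    refine ⟨hP, ?_, ?_⟩
    · rw [Matrix.isUnit_iff_isUnit_det, Matrix.det_smul, Matrix.det_one, mul_one]
      exact (isUnit_iff_ne_zero.2 (neg_ne_zero.2 (one_div_pos.2 hτ).ne')).pow _
    · rw [lowerBlock_smul, lowerBlock_one_five_two, jacobianMatrix_bgkSource τ
        (by rw [h.momentMap_zero hK heven hσ]; exact h.pos) (h.temperature_pos hK heven hσ)]
      have := hermiteMatrix_mul_sourceJacobian τ (meanVelocity (momentMap K W))
        (temperature (momentMap K W))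
      rw [this, Matrix.smul_mul, Matrix.mul_assoc,
        Matrix.mul_nonsing_inv _ ((Matrix.isUnit_iff_isUnit_det _).1 hP), Matrix.mul_one]
  · intro M hM
    exact ⟨(hA₀ M hM).1, (hA₀ M hM).2.1⟩
  · intro M hM
    rw [lowerBlock_one_five_two]
    exact (hA₀ M hM.1).2.2 hM

theorem lt_five_of_structuralStability {τ : ℝ} (hτ : 0 < τ)
    (hS : StructuralStability (stateSpace K) (coeffMatrix K) (bgkSource τ)) :
    kernelMoment K 4 < 5 := by
  obtain ⟨r, -, hr, P, T, A₀, hI, hII, hIII⟩ := hS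
  obtain ⟨W, hW, x, y, h, h4, h0⟩ := exists_equilibrium hK heven h3 hτ
  have hσ := hW.2.2.2
  have hM : momentMap K W ∈ equilibria (stateSpace K) (bgkSource τ) := ⟨⟨W, hW, rfl⟩, h0⟩
  obtain ⟨hxy, hE⟩ := (h.equilibrium_iff hK heven h3 hσ hτ).1 h0
  obtain ⟨hP, hT, hJ⟩ := hI _ hM
  obtain ⟨hpd, hsym⟩ := hII _ hM.1
  have hker := fun v => transpose_mulVec_eq_zero_of_clauses hr hP hT hJ (hIII _ hM) (v := v)
  rw [jacobianMatrix_bgkSource τ (by rw [h.momentMap_zero hK heven hσ]; exact h.pos)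
    (h.temperature_pos hK heven hσ), h.meanVelocity_eq hK heven hσ,
    h.temperature_eq hK heven hσ] at hker
  rw [coeffMatrix_momentMap hK heven h3 hW,
    h.paramCoeff_of_equilibrium h3 hxy hE] at hsym
  generalize A₀ (momentMap K W) = A at hpd hsym hker
  rw [h4, one_pow, mul_one] at hE
  rw [h4, one_pow, hE] at hsym hker
  set e := √((kernelMoment K 4 - 3) / 2)
  have h33 : 0 < A 3 3 := hpd.diag_pos
  have h44 : 0 < A 4 4 := hpd.diag_pos
  -- The kernel vector is the derivative in `θ` of the Gaussian moments `(1, 0, θ, 0, 3θ²)` at `θ =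
  -- e + 1`. The last component reads `A₄₂ + 6(e + 1) A₄₄ = 0`.
  have hk := congrFun (hker ![0, 0, 1, 0, 6 * (e + 1)] (by
    funext i
    fin_cases i <;> simp [sourceJacobian, hermiteThree, hermiteFour]
    ring)) 4
  simp [sourceJacobian, hermiteThree, hermiteFour, Matrix.mulVec, dotProduct,
    Fin.sum_univ_five, hτ.ne'] at hk
  -- This entry reads `A₄₂ + (10 + 2e) A₄₄ = A₃₃`; eliminating `A₄₂` leaves `A₃₃ = (4 - 4e) A₄₄`,
  -- and both diagonal entries are positive.
  have hs := congrFun (congrFun hsym 4) 3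
  simp [Matrix.mul_apply, Fin.sum_univ_five, companionMatrix, equilibriumCoeff] at hs
  have h1 : e < 1 := by
    have : 0 < (4 - 4 * e) * A 4 4 := by linarith
    have := (pos_iff_pos_of_mul_pos this).2 h44
    linarith
  have := (Real.sqrt_lt' one_pos).1 h1
  linarith

end

theorem mainTheorem5 (K : ℝ → ℝ) (hK : IsNormalizedKernel K) (heven : Function.Even K)
    (h3 : 3 ≤ kernelMoment K 4) (h6 : kernelMoment K 4 < 6) (τ : ℝ) (hτ : 0 < τ) :
    IsWellDefinedSystem K τ ∧
      (StructuralStability (stateSpace K) (coeffMatrix K) (bgkSource τ) ↔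
        (3 ≤ kernelMoment K 4 ∧ kernelMoment K 4 < 5)) :=
  ⟨isWellDefinedSystem hK heven h3 hτ,
    fun h => ⟨h3, lt_five_of_structuralStability hK heven h3 hτ h⟩,
    fun h => structuralStability_of_lt hK heven h3 h.2 hτ⟩
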